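/- Let $(M,g)$ be a smooth 4-dimensional pseudo-Riemannian manifold (of arbitrary signature) with Levi-Civita connection $\nabla$. Conventions: $\nabla_a\nabla_b\omega_c-\nabla_b\nabla_a\omega_c=R_{abc}{}^d\omega_d$, $R_{ac}=R_{abc}{}^b$, $R=g^{ab}R_{ab}$, $L_{ab}=\tfrac12\bigl(R_{ab}-\tfrac16Rg_{ab}\bigr)$, and $C_{abc}{}^d=R_{abc}{}^d-2L^d{}_{[b}g_{a]c}-2\delta^d{}_{[b}L_{a]c}$ is the Weyl tensor; indices are moved with $g$, and square brackets denote antisymmetrization with weight one ($T_{[ab]}=\tfrac12(T_{ab}-T_{ba})$). Assume that $C\cdot C:=C_{abcd}C^{abcd}$ vanishes at no point of $M$, and put $$\Lambda_d:=\frac{8\,C_d{}^{amp}\,\nabla_{[m}L_{p]a}}{C\cdot C}.$$ Let $\mathcal C$ be the torsion-free connection given by $$\mathcal C_a\omega_b=\nabla_a\omega_b-\bigl(g^{cd}g_{ab}\Lambda_d-\delta_b{}^c\Lambda_a-\delta_a{}^c\Lambda_b\bigr)\omega_c ,$$ let $\mathcal R_{abc}{}^d$ be its curvature, $(\mathcal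 C_a\mathcal C_b-\mathcal C_b\mathcal C_a)\omega_c=\mathcal R_{abc}{}^d\omega_d$, $\mathcal R_{ab}:=\mathcal R_{adb}{}^d$ its Ricci tensor, and $\mathcal R:=g^{ab}\mathcal R_{ab}$. Then $(M,g)$ is locally conformal to an Einstein manifold, that is, every point of $M$ has an open neighbourhood $U$ with a smooth function $\Theta>0$ on $U$ such that the metric $\tilde g=\Theta^{-2}g$ on $U$ satisfies $\tilde R_{ab}=\lambda\,\tilde g_{ab}$ for some constant $\lambda\in\mathbb R$, if and only if $$\mathcal R_{[ab]}=0\qquad\text{and}\qquad \mathcal R_{ab}-\tfrac14\,g_{ab}\,\mathcal R=0$$ hold on $M$. -/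

import Mathlib

open scoped Manifold ContDiff Bundle

noncomputable section

namespace CConn

/-! ### Tensor calculus in a coordinate domain of `ℝ⁴`

`G` is the matrix of components of a metric, `Γ` the coefficients of a connection, both as functions
of the coordinates. The index order of an array is the index order of the tensor, read from left to
right (`Γ y c a b` is `Γ^c_{ab}`, `riemann Γ y a b c d` is `R_{abc}^d`). -/

/-- The coordinate space. -/
abbrev E4 : Type := EuclideanSpace ℝ (Fin 4)

/-- The `i`-th coordinate vector. -/
def basisVec (i : Fin 4) : E4 := EuclideanSpace.single i 1

/-- The partial derivative `∂_i f` at `y`. -/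
def partialD (i : Fin 4) (f : E4 → ℝ) (y : E4) : ℝ := fderiv ℝ f y (basisVec i)

/-- Components of the Kronecker tensor `δ_b^c`. -/
def delta (c b : Fin 4) : ℝ := if c = b then 1 else 0

/-- The inverse metric `g^{ab}`. -/
def ginv (G : E4 → Matrix (Fin 4) (Fin 4) ℝ) (y : E4) : Matrix (Fin 4) (Fin 4) ℝ := (G y)⁻¹

/-- Curvature of a torsion-free connection `∇_a ω_b = ∂_a ω_b - Γ^c_{ab} ω_c`, with the convention
`∇_a ∇_b ω_c - ∇_b ∇_a ω_c = R_{abc}^d ω_d`. -/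
def riemann (Γ : E4 → Fin 4 → Fin 4 → Fin 4 → ℝ) (y : E4) (a b c d : Fin 4) : ℝ :=
  partialD b (fun z => Γ z d a c) y - partialD a (fun z => Γ z d b c) y
    + ∑ e, (Γ y e a c * Γ y d b e - Γ y e b c * Γ y d a e)

/-- Ricci tensor of a connection, `R_{ac} = R_{abc}^b`. -/
def ricci (Γ : E4 → Fin 4 → Fin 4 → Fin 4 → ℝ) (y : E4) (a c : Fin 4) : ℝ :=
  ∑ b, riemann Γ y a b c b

section Metric

variable (G : E4 → Matrix (Fin 4) (Fin 4) ℝ) (y : E4)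

/-- Christoffel symbols `Γ^c_{ab}` of the Levi-Civita connection `∇`. -/
def christoffel (c a b : Fin 4) : ℝ :=
  (1 / 2) * ∑ d, ginv G y c d *
    (partialD a (fun z => G z d b) y + partialD b (fun z => G z d a) y
      - partialD d (fun z => G z a b) y)

/-- Ricci tensor `R_{ab}` of the metric. -/
def metricRicci (a b : Fin 4) : ℝ := ricci (christoffel G) y a b

/-- Scalar curvature `R = g^{ab} R_{ab}` of the metric. -/
def scalarCurv : ℝ := ∑ a, ∑ b, ginv G y a b * metricRicci G y a b

/-- Schouten tensor `L_{ab} = (R_{ab} - R g_{ab} / 6) / 2`. -/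
def schouten (a b : Fin 4) : ℝ :=
  (1 / 2) * (metricRicci G y a b - (1 / 6) * scalarCurv G y * G y a b)

/-- `L^d_b = g^{de} L_{eb}`. -/
def schoutenUp (d b : Fin 4) : ℝ := ∑ e, ginv G y d e * schouten G y e b

/-- Weyl tensor `C_{abc}^d = R_{abc}^d - 2 L^d_{[b} g_{a]c} - 2 δ^d_{[b} L_{a]c}`. -/
def weyl (a b c d : Fin 4) : ℝ :=
  riemann (christoffel G) y a b c d
    - (schoutenUp G y d b * G y a c - schoutenUp G y d a * G y b c)
    - (delta d b * schouten G y a c - delta d a * schouten G y b c)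

/-- `C_{abcd} = C_{abc}^e g_{ed}`. -/
def weylDown (a b c d : Fin 4) : ℝ := ∑ e, weyl G y a b c e * G y e d

/-- `C_a^{bcd} = C_{aefh} g^{eb} g^{fc} g^{hd}`. -/
def weylUp (a b c d : Fin 4) : ℝ :=
  ∑ e, ∑ f, ∑ h, weylDown G y a e f h * ginv G y e b * ginv G y f c * ginv G y h d

/-- The scalar `C·C = C_{abcd} C^{abcd}`. -/
def weylSq : ℝ :=
  ∑ a, ∑ b, ∑ c, ∑ d, weylDown G y a b c d * ∑ e, ginv G y a e * weylUp G y e b c d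

/-- `∇_m L_{pa}`. -/
def nablaSchouten (m p a : Fin 4) : ℝ :=
  partialD m (fun z => schouten G z p a) y
    - ∑ e, (christoffel G y e m p * schouten G y e a + christoffel G y e m a * schouten G y p e)

/-- The covector `Λ_d = 8 C_d^{amp} ∇_{[m} L_{p]a} / (C·C)`. -/
def lam (d : Fin 4) : ℝ :=
  8 * (∑ a, ∑ m, ∑ p, weylUp G y d a m p *
    ((1 / 2) * (nablaSchouten G y m p a - nablaSchouten G y p m a))) / weylSq G y

/-- Coefficients of the `𝒞`-connection: those of `∇` plus the transition tensor
`g^{cd} g_{ab} Λ_d - δ_b^c Λ_a - δ_a^c Λ_b`. -/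
def cCoeff (c a b : Fin 4) : ℝ :=
  christoffel G y c a b
    + ((∑ d, ginv G y c d * G y a b * lam G y d) - delta c b * lam G y a - delta c a * lam G y b)

/-- Ricci tensor `𝓡_{ab}` of the `𝒞`-connection. -/
def cRicci (a b : Fin 4) : ℝ := ricci (cCoeff G) y a b

/-- The trace `𝓡 = g^{ab} 𝓡_{ab}`. -/
def cScalar : ℝ := ∑ a, ∑ b, ginv G y a b * cRicci G y a b

end Metric

/-! ### Four-dimensional pseudo-Riemannian manifolds -/

variable {M : Type*} [TopologicalSpace M] [ChartedSpace E4 M]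

/-- A (not necessarily nondegenerate or smooth) field of bilinear forms on the tangent spaces. -/
abbrev BilinField (M : Type*) [TopologicalSpace M] [ChartedSpace E4 M] : Type _ :=
  ∀ x : M, TangentSpace (𝓡 4) x →L[ℝ] TangentSpace (𝓡 4) x →L[ℝ] ℝ

/-- A smooth pseudo-Riemannian metric on `M`: a smooth field of nondegenerate symmetric bilinear
forms, of arbitrary signature. -/
structure PseudoRiemannianMetric (M : Type*) [TopologicalSpace M] [ChartedSpace E4 M]
    [IsManifold (𝓡 4) ∞ M] where
  form : BilinField M
  symm : ∀ (x : M) (v w : TangentSpace (𝓡 4) x), form x v w = form x w v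
  nondegenerate : ∀ (x : M) (v : TangentSpace (𝓡 4) x), (∀ w, form x v w = 0) → v = 0
  contMDiff : ContMDiff (𝓡 4) ((𝓡 4).prod 𝓘(ℝ, E4 →L[ℝ] E4 →L[ℝ] ℝ)) ∞
    (fun x => Bundle.TotalSpace.mk' (E4 →L[ℝ] E4 →L[ℝ] ℝ) x (form x))

/-- Components of a field of bilinear forms in the chart `e`, i.e. its values on the coordinate
vector fields, as functions of the coordinates `y ∈ e.target`. -/
def components (h : BilinField M) (e : OpenPartialHomeomorph M E4) (y : E4) :
    Matrix (Fin 4) (Fin 4) ℝ :=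
  Matrix.of fun a b =>
    h (e.symm y) (mfderiv (𝓡 4) (𝓡 4) e.symm y (basisVec a))
      (mfderiv (𝓡 4) (𝓡 4) e.symm y (basisVec b))

/-- `C·C` vanishes nowhere on `M`. -/
def WeylSqNeZero [IsManifold (𝓡 4) ∞ M] (g : PseudoRiemannianMetric M) : Prop :=
  ∀ e ∈ IsManifold.maximalAtlas (𝓡 4) ∞ M, ∀ y ∈ e.target, weylSq (components g.form e) y ≠ 0

/-- The metric `h` is an Einstein metric on the open set `U`: its Ricci tensor is a constant
multiple of it there (as a tensor equation, i.e. in all smooth charts). -/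
def IsEinsteinOn (h : BilinField M) (U : Set M) : Prop :=
  ∃ c : ℝ, ∀ e ∈ IsManifold.maximalAtlas (𝓡 4) ∞ M, ∀ y ∈ e.target, e.symm y ∈ U →
    ∀ a b, metricRicci (components h e) y a b = c * components h e y a b

/-- Every point has an open neighbourhood `U` with a smooth positive function `Θ` on it such that
`g = Θ² h` on `U` for an Einstein metric `h = Θ⁻² g`. -/
def LocallyConformallyEinstein [IsManifold (𝓡 4) ∞ M] (g : PseudoRiemannianMetric M) : Prop :=
  ∀ x : M, ∃ U : Set M, IsOpen U ∧ x ∈ U ∧ ∃ Θ : M → ℝ,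
    ContMDiffOn (𝓡 4) 𝓘(ℝ, ℝ) ∞ Θ U ∧ (∀ z ∈ U, 0 < Θ z) ∧
      IsEinsteinOn (fun z => ((Θ z) ^ 2)⁻¹ • g.form z) U

/-- `𝓡_{[ab]} = 0` on `M`. -/
def CRicciSkewPartVanishes [IsManifold (𝓡 4) ∞ M] (g : PseudoRiemannianMetric M) : Prop :=
  ∀ e ∈ IsManifold.maximalAtlas (𝓡 4) ∞ M, ∀ y ∈ e.target, ∀ a b,
    (1 / 2) * (cRicci (components g.form e) y a b - cRicci (components g.form e) y b a) = 0

/-- `𝓡_{ab} - (1/4) g_{ab} 𝓡 = 0` on `M`. -/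
def CRicciTraceFreePartVanishes [IsManifold (𝓡 4) ∞ M] (g : PseudoRiemannianMetric M) : Prop :=
  ∀ e ∈ IsManifold.maximalAtlas (𝓡 4) ∞ M, ∀ y ∈ e.target, ∀ a b,
    cRicci (components g.form e) y a b
      - (1 / 4) * components g.form e y a b * cScalar (components g.form e) y = 0

end CConn

end

noncomputable section

namespace CConn

open Set Filter Topology

/-! ### Components of the metric in charts, and their change between charts -/

section ManifoldPart

variable {M : Type*} [TopologicalSpace M] [ChartedSpace E4 M]

/-! The transition tensor of `𝒞` has the form `weylShift` of a covector `u`. When `u = d log Θ`,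
this is exactly how the Levi-Civita connection changes under `g ↦ Θ⁻² g` (`IsLeviCivita.conformal`).
The point is that `Λ` is the only candidate for `d log Θ`, and that the two Ricci conditions say
that this candidate works.

Necessity. Let `Θ⁻² g` be Einstein and `u = d log Θ`. The transformation law of the Ricci tensor
(`IsLeviCivita.ric_add_weylShift`) can be solved for `L = -∇u - u ⊗ u + q g`. Antisymmetrizing `∇L`
and using the Ricci identity gives `2 ∇_{[m} L_{p]a} = -C_{mpa}^d u_d` (`IsLeviCivita.cotton_eq`).
In dimension four `C_d^{amp} C_{mpa}^e = -(1/4) δ_d^e C·C` (`IsMetricOn.sum_weylUp_mul_weyl`), so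
contraction with `C_d^{amp}` recovers `u` from the Cotton tensor: `u = Λ`, because `C·C` has no
zeros. Hence `𝒞` is locally the Levi-Civita connection of an Einstein metric conformal to `g`, and
its Ricci tensor is a multiple of `g` at each point.

Sufficiency. The Ricci tensor of `∇` is symmetric, so the skew part of `𝓡_{ab}` is a multiple of
`dΛ` and its vanishing makes `Λ` closed (`IsLeviCivita.closed_of_ric_symm`). On a coordinate ball `Λ
= df` (`exists_potential`), and for `Θ = exp f` the connection `𝒞` is that of `Θ⁻² g`. The
trace-free condition makes its Ricci tensor a function times the metric; Schur's lemma, that is, the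
contracted Bianchi identity (`IsLeviCivita.deriv_eq_zero_of_ric_eq`), makes the function constant.
Tensoriality of the Ricci tensor (`metricRicci_transition`) carries the equation from one chart to
all of them.

The differential identities are proved over any commutative `ℝ`-algebra with four commuting
derivations, a connection being four 4×4 matrices, so that they become matrix algebra. They are
applied to the algebra `SmoothFn U`; evaluation at points (`ev`) links them to the coordinate
definitions. The algebraic identities of the Weyl tensor are proved pointwise over `ℝ`. -/

/-- A coordinate vector field is the tangent map of `e.symm` applied to a constant section of the
tangent bundle of `E4`. -/
theorem contMDiffOn_coordVector [IsManifold (𝓡 4) ∞ M] {e : OpenPartialHomeomorph M E4}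
    (he : e ∈ IsManifold.maximalAtlas (𝓡 4) ∞ M) (v : E4) :
    ContMDiffOn (𝓡 4) ((𝓡 4).prod (𝓡 4)) ∞
      (fun y : E4 => (Bundle.TotalSpace.mk' E4 (e.symm y) (mfderiv (𝓡 4) (𝓡 4) e.symm y v) :
        TangentBundle (𝓡 4) M)) e.target := by
  have h1 : ContMDiffOn (𝓡 4) (𝓡 4) ∞ e.symm e.target := contMDiffOn_symm_of_mem_maximalAtlas he
  have h2 := h1.contMDiffOn_tangentMapWithin (m := ∞) (by simp) e.open_target.uniqueMDiffOn
  have h3 : ContMDiffOn (𝓡 4) ((𝓡 4).prod (𝓡 4)) ∞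
      (fun y : E4 => (Bundle.TotalSpace.mk' E4 y v : TangentBundle (𝓡 4) E4)) e.target := by
    intro y hy
    rw [Bundle.contMDiffWithinAt_totalSpace]
    refine ⟨contMDiffWithinAt_id, ?_⟩
    simpa using contMDiffWithinAt_const
  have h4 := h2.comp h3 (fun y hy => by simpa using hy)
  refine h4.congr fun y hy => ?_
  simp only [Function.comp, tangentMapWithin]
  rw [mfderivWithin_of_isOpen e.open_target hy]

theorem contDiffOn_components [IsManifold (𝓡 4) ∞ M] (g : PseudoRiemannianMetric M)
    {e : OpenPartialHomeomorph M E4} (he : e ∈ IsManifold.maximalAtlas (𝓡 4) ∞ M) (a b : Fin 4) :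
    ContDiffOn ℝ ∞ (fun y => components g.form e y a b) e.target := by
  have h1 : ContMDiffOn (𝓡 4) (𝓡 4) ∞ e.symm e.target := contMDiffOn_symm_of_mem_maximalAtlas he
  rw [← contMDiffOn_iff_contDiffOn]
  -- Components are viewed as a section of the trivial line bundle, where smooth bilinear forms can
  -- be applied to smooth sections.
  have : ContMDiffOn (𝓡 4) ((𝓡 4).prod 𝓘(ℝ, ℝ)) ∞
      (fun y => Bundle.TotalSpace.mk' ℝ (E := Bundle.Trivial M ℝ) (e.symm y)
        (components g.form e y a b)) e.target := by
    apply ContMDiffOn.clm_bundle_apply₂ (F₁ := E4) (F₂ := E4)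
    · exact g.contMDiff.comp_contMDiffOn h1
    · exact contMDiffOn_coordVector he (basisVec a)
    · exact contMDiffOn_coordVector he (basisVec b)
  intro y hy
  have h := this y hy
  simp only [Bundle.contMDiffWithinAt_totalSpace] at h
  exact h.2

theorem components_symm [IsManifold (𝓡 4) ∞ M] (g : PseudoRiemannianMetric M)
    (e : OpenPartialHomeomorph M E4) (y : E4) (a b : Fin 4) :
    components g.form e y a b = components g.form e y b a :=
  g.symm _ _ _

theorem sum_basisVec (v : E4) : v = ∑ i, v i • basisVec i := by
  ext j
  simp [basisVec, Finset.sum_apply, Pi.single_apply]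

theorem bilin_comp_apply_eq_sum (H : E4 →L[ℝ] E4 →L[ℝ] ℝ) (T : E4 →L[ℝ] E4) (V W : E4) :
    H (T V) (T W) = ∑ b, W b * ∑ a, V a * H (T (basisVec a)) (T (basisVec b)) := by
  conv_lhs => rw [sum_basisVec V, sum_basisVec W]
  simp only [map_sum, map_smul, sum_apply, smul_apply, smul_eq_mul]

/-- A null vector of the component matrix is sent by the derivative `T` of `e.symm` into the radical
of `g`, hence to `0`. The derivative of `e` inverts `T`, so the vector itself is `0`. -/
theorem isUnit_det_components [IsManifold (𝓡 4) ∞ M] (g : PseudoRiemannianMetric M)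
    {e : OpenPartialHomeomorph M E4} (he : e ∈ IsManifold.maximalAtlas (𝓡 4) ∞ M) {y : E4}
    (hy : y ∈ e.target) : IsUnit (components g.form e y).det := by
  rw [isUnit_iff_ne_zero]
  intro h0
  obtain ⟨v, hv0, hv⟩ := Matrix.exists_vecMul_eq_zero_iff.mpr h0
  have hd : MDifferentiableAt (𝓡 4) (𝓡 4) e.symm y :=
    ((contMDiffOn_symm_of_mem_maximalAtlas he).contMDiffAt
      (e.open_target.mem_nhds hy)).mdifferentiableAt (by simp)
  have hd' : MDifferentiableAt (𝓡 4) (𝓡 4) e (e.symm y) :=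
    ((contMDiffOn_of_mem_maximalAtlas he).contMDiffAt
      (e.open_source.mem_nhds (e.map_target hy))).mdifferentiableAt (by simp)
  set T := mfderiv (𝓡 4) (𝓡 4) e.symm y
  have hleft : ∀ w : E4, mfderiv (𝓡 4) (𝓡 4) e (e.symm y) (T w) = w := by
    intro w
    have h1 := mfderiv_comp y hd' hd
    have h2 : mfderiv (𝓡 4) (𝓡 4) (e ∘ e.symm) y = ContinuousLinearMap.id ℝ E4 := by
      have : (e ∘ e.symm) =ᶠ[𝓝 y] id := by
        filter_upwards [e.open_target.mem_nhds hy] with z hz using e.right_inv hz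
      rw [this.mfderiv_eq]; exact mfderiv_id
    rw [h2] at h1
    exact (congrArg (fun L : E4 →L[ℝ] E4 => L w) h1).symm
  have hright : ∀ w : TangentSpace (𝓡 4) (e.symm y), T (mfderiv (𝓡 4) (𝓡 4) e (e.symm y) w) = w := by
    intro w
    have hd2 : MDifferentiableAt (𝓡 4) (𝓡 4) e.symm (e (e.symm y)) := by
      rw [e.right_inv hy]; exact hd
    have h1 := mfderiv_comp (e.symm y) hd2 hd'
    have h2 : mfderiv (𝓡 4) (𝓡 4) (e.symm ∘ e) (e.symm y) = ContinuousLinearMap.id ℝ E4 := by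
      have : (e.symm ∘ e) =ᶠ[𝓝 (e.symm y)] id := by
        filter_upwards [e.open_source.mem_nhds (e.map_target hy)] with z hz using e.left_inv hz
      rw [this.mfderiv_eq]; exact mfderiv_id
    rw [h2, e.right_inv hy] at h1
    exact (congrArg (fun L : E4 →L[ℝ] E4 => L w) h1).symm
  let V : E4 := WithLp.toLp 2 v
  have hV : T V = 0 := by
    apply g.nondegenerate
    intro w
    rw [← hright w]
    set W : E4 := mfderiv (𝓡 4) (𝓡 4) e (e.symm y) w
    have hbil : g.form (e.symm y) (T V) (T W)
        = ∑ b, W b * ∑ a, v a * components g.form e y a b :=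
      bilin_comp_apply_eq_sum (g.form (e.symm y)) T V W
    rw [hbil]
    refine Finset.sum_eq_zero fun b _ => ?_
    have := congrFun hv b
    simp only [Matrix.vecMul, dotProduct, Pi.zero_apply] at this
    rw [this, mul_zero]
  apply hv0
  have h5 := hleft V
  rw [hV, map_zero] at h5
  funext i
  have := congrArg (fun w : E4 => w i) h5
  exact this.symm

/-- The Jacobian matrix `∂_a φ^k` of a map between coordinate domains. -/
def jacobian (φ : E4 → E4) (y : E4) : Matrix (Fin 4) (Fin 4) ℝ :=
  Matrix.of fun k a => partialD a (fun z => φ z k) y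

theorem contDiffOn_transition [IsManifold (𝓡 4) ∞ M] {e e' : OpenPartialHomeomorph M E4}
    (he : e ∈ IsManifold.maximalAtlas (𝓡 4) ∞ M) (he' : e' ∈ IsManifold.maximalAtlas (𝓡 4) ∞ M) :
    ContDiffOn ℝ ∞ (fun y => e' (e.symm y)) (e.symm.trans e').source := by
  rw [← contMDiffOn_iff_contDiffOn]
  refine (contMDiffOn_of_mem_maximalAtlas he').comp
    ((contMDiffOn_symm_of_mem_maximalAtlas he).mono ?_) ?_
  · intro y hy; simp at hy; exact hy.1
  · intro y hy; simp at hy; exact hy.2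

/-- Near `y` one has `e.symm = e'.symm ∘ φ`, so by the chain rule the coordinate vectors of `e` are
Jacobian combinations of those of `e'`. -/
theorem components_transition [IsManifold (𝓡 4) ∞ M] (h : BilinField M)
    {e e' : OpenPartialHomeomorph M E4}
    (he : e ∈ IsManifold.maximalAtlas (𝓡 4) ∞ M) (he' : e' ∈ IsManifold.maximalAtlas (𝓡 4) ∞ M)
    {y : E4} (hy : y ∈ (e.symm.trans e').source) :
    components h e y = (jacobian (fun y => e' (e.symm y)) y).transpose
      * components h e' (e' (e.symm y)) * jacobian (fun y => e' (e.symm y)) y := by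
  have hy' : y ∈ e.target ∧ e.symm y ∈ e'.source := by simpa using hy
  set φ : E4 → E4 := fun y => e' (e.symm y)
  have hφd : DifferentiableAt ℝ φ y :=
    ((contDiffOn_transition he he').contDiffAt
      ((e.symm.trans e').open_source.mem_nhds hy)).differentiableAt (by simp)
  have hd' : MDifferentiableAt (𝓡 4) (𝓡 4) e'.symm (φ y) :=
    ((contMDiffOn_symm_of_mem_maximalAtlas he').contMDiffAt
      (e'.open_target.mem_nhds (e'.map_source hy'.2))).mdifferentiableAt (by simp)
  have key : ∀ v : E4, (mfderiv (𝓡 4) (𝓡 4) e.symm y v : E4)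
      = (mfderiv (𝓡 4) (𝓡 4) e'.symm (φ y) (fderiv ℝ φ y v) : E4) := by
    intro v
    have h1 := mfderiv_comp y hd' hφd.mdifferentiableAt
    have h2 : mfderiv (𝓡 4) (𝓡 4) (e'.symm ∘ φ) y = mfderiv (𝓡 4) (𝓡 4) e.symm y := by
      apply Filter.EventuallyEq.mfderiv_eq
      filter_upwards [(e.symm.trans e').open_source.mem_nhds hy] with z hz
      have hz' : z ∈ e.target ∧ e.symm z ∈ e'.source := by simpa using hz
      exact e'.left_inv hz'.2
    rw [h2, mfderiv_eq_fderiv] at h1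
    exact (congrArg (fun L : E4 →L[ℝ] E4 => L v) h1)
  have hJ : ∀ a, fderiv ℝ φ y (basisVec a) = ∑ k, jacobian φ y k a • basisVec k := by
    intro a
    conv_lhs => rw [sum_basisVec (fderiv ℝ φ y (basisVec a))]
    refine Finset.sum_congr rfl fun k _ => ?_
    congr 1
    simp only [jacobian, Matrix.of_apply, partialD]
    have : fderiv ℝ (fun z => φ z k) y = (EuclideanSpace.proj k : E4 →L[ℝ] ℝ).comp (fderiv ℝ φ y) :=
      ((EuclideanSpace.proj k : E4 →L[ℝ] ℝ).hasFDerivAt.comp y hφd.hasFDerivAt).fderiv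
    rw [this]; rfl
  have hbase : e'.symm (φ y) = e.symm y := e'.left_inv hy'.2
  have hform : ∀ (p q : M) (_ : p = q) (v w : E4), (h p : E4 →L[ℝ] E4 →L[ℝ] ℝ) v w
      = (h q : E4 →L[ℝ] E4 →L[ℝ] ℝ) v w := by
    rintro p _ rfl v w; rfl
  ext a b
  simp only [components, Matrix.of_apply, Matrix.mul_apply, Matrix.transpose_apply]
  refine (hform _ _ hbase.symm _ _).trans ?_
  set H : E4 →L[ℝ] E4 →L[ℝ] ℝ := h (e'.symm (φ y))
  rw [key, key, hJ, hJ]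
  set T : E4 →L[ℝ] E4 := mfderiv (𝓡 4) (𝓡 4) e'.symm (φ y)
  change H (T _) (T _) = ∑ j, (∑ i, _ * H (T _) (T _)) * _
  simp only [map_sum, map_smul, sum_apply, smul_apply,
        smul_eq_mul]
  refine Finset.sum_congr rfl fun j _ => ?_
  rw [mul_comm]

end ManifoldPart

end CConn

namespace CConn

open Set Filter Topology

/-! ### The algebra of smooth functions on an open set and its partial derivatives -/

section SmoothFunctions

variable (U : TopologicalSpace.Opens E4)

/-- Extension by zero of a function on an open set. -/
def zeroExtend {U : TopologicalSpace.Opens E4} (f : U → ℝ) : E4 → ℝ :=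
  Function.extend Subtype.val f 0

theorem zeroExtend_apply {U : TopologicalSpace.Opens E4} (f : U → ℝ) (y : U) :
    zeroExtend f y = f y :=
  Subtype.val_injective.extend_apply _ _ _

/-- The algebra of smooth functions on an open subset of the coordinate space. -/
def SmoothFn : Subalgebra ℝ (U → ℝ) where
  carrier := {f | ContDiffOn ℝ ∞ (zeroExtend f) U}
  mul_mem' {f g} hf hg := (ContDiffOn.mul hf hg).congr fun y hy => by
    simp only [zeroExtend_apply _ ⟨y, hy⟩, Pi.mul_apply]
  add_mem' {f g} hf hg := (ContDiffOn.add hf hg).congr fun y hy => by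
    simp only [zeroExtend_apply _ ⟨y, hy⟩, Pi.add_apply]
  algebraMap_mem' r := (contDiffOn_const (c := r)).congr fun y hy => by
    rw [zeroExtend_apply _ ⟨y, hy⟩]; rfl

variable {U}

namespace SmoothFn

theorem ext_apply {f g : SmoothFn U} (h : ∀ y : U, f.1 y = g.1 y) : f = g :=
  Subtype.ext (funext h)

/-- Restriction of a function that is smooth on `U`. -/
def mk (F : E4 → ℝ) (hF : ContDiffOn ℝ ∞ F U) : SmoothFn U :=
  ⟨fun y => F y, hF.congr fun y hy => zeroExtend_apply _ ⟨y, hy⟩⟩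

theorem contDiffOn (f : SmoothFn U) : ContDiffOn ℝ ∞ (zeroExtend f.1) U := f.2

theorem contDiffOn_of_eq (f : SmoothFn U) {F : E4 → ℝ} (h : ∀ y : U, F y = f.1 y) :
    ContDiffOn ℝ ∞ F U :=
  (contDiffOn f).congr fun y hy => by rw [zeroExtend_apply _ ⟨y, hy⟩]; exact h ⟨y, hy⟩

theorem differentiableAt (f : SmoothFn U) (y : U) : DifferentiableAt ℝ (zeroExtend f.1) y :=
  ((contDiffOn f).contDiffAt (U.isOpen.mem_nhds y.2)).differentiableAt (by simp)

theorem contDiffOn_partialD {F : E4 → ℝ} {s : Set E4} (hs : IsOpen s) (hF : ContDiffOn ℝ ∞ F s)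
    (i : Fin 4) : ContDiffOn ℝ ∞ (partialD i F) s :=
  (hF.fderiv_of_isOpen (m := ∞) hs (by simp)).clm_apply contDiffOn_const

/-- Derivatives at points of an open set see only the values on that set; this is why extension by
zero is harmless. -/
theorem partialD_congr {F F' : E4 → ℝ} (h : ∀ y ∈ U, F y = F' y) (i : Fin 4) (y : U) :
    partialD i F y = partialD i F' y := by
  have : F =ᶠ[𝓝 (y : E4)] F' := by
    filter_upwards [U.isOpen.mem_nhds y.2] with z hz using h z hz
  simp only [partialD, this.fderiv_eq]

theorem partialD_zeroExtend {f : SmoothFn U} {F : E4 → ℝ} (h : ∀ y : U, F y = f.1 y) (i : Fin 4)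
    (y : U) : partialD i F y = partialD i (zeroExtend f.1) y :=
  partialD_congr (fun z hz => by rw [zeroExtend_apply _ ⟨z, hz⟩]; exact h ⟨z, hz⟩) i y

/-- The partial derivative `∂_i` as a derivation of the algebra of smooth functions. -/
def D (i : Fin 4) : Derivation ℝ (SmoothFn U) (SmoothFn U) :=
  Derivation.mk'
    { toFun := fun f => mk (partialD i (zeroExtend f.1))
        (contDiffOn_partialD U.isOpen (contDiffOn f) i)
      map_add' := fun f g => ext_apply fun y => by
        have := partialD_zeroExtend (f := f + g) (F := zeroExtend f.1 + zeroExtend g.1)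
          (fun z => by simp only [Pi.add_apply, zeroExtend_apply]; rfl) i y
        change partialD i (zeroExtend (f + g).1) y
          = partialD i (zeroExtend f.1) y + partialD i (zeroExtend g.1) y
        rw [← this]
        simp only [partialD]
        rw [fderiv_add (differentiableAt f y) (differentiableAt g y)]
        rfl
      map_smul' := fun r f => ext_apply fun y => by
        have := partialD_zeroExtend (f := r • f) (F := r • zeroExtend f.1)
          (fun z => by simp only [Pi.smul_apply, zeroExtend_apply]; rfl) i y
        change partialD i (zeroExtend (r • f).1) y = r * partialD i (zeroExtend f.1) y
        rw [← this]
        simp only [partialD]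
        rw [fderiv_const_smul (differentiableAt f y)]
        rfl }
    (fun f g => ext_apply fun y => by
        have := partialD_zeroExtend (f := f * g) (F := zeroExtend f.1 * zeroExtend g.1)
          (fun z => by simp only [Pi.mul_apply, zeroExtend_apply]; rfl) i y
        change partialD i (zeroExtend (f * g).1) y
          = f.1 y * partialD i (zeroExtend g.1) y + g.1 y * partialD i (zeroExtend f.1) y
        rw [← this, ← zeroExtend_apply f.1, ← zeroExtend_apply g.1]
        simp only [partialD]
        rw [fderiv_mul (differentiableAt f y) (differentiableAt g y)]
        rfl)

theorem D_apply (i : Fin 4) (f : SmoothFn U) (y : U) :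
    (D i f).1 y = partialD i (zeroExtend f.1) y := rfl

/-- `partialD` computes the derivation `D`. -/
theorem partialD_eq {f : SmoothFn U} {F : E4 → ℝ} (h : ∀ y : U, F y = f.1 y) (i : Fin 4) (y : U) :
    partialD i F y = (D i f).1 y :=
  partialD_zeroExtend h i y

theorem D_comm (i j : Fin 4) (f : SmoothFn U) : D i (D j f) = D j (D i f) := by
  apply ext_apply
  intro y
  have h2 : ContDiffAt ℝ 2 (zeroExtend f.1) y :=
    ((contDiffOn f).contDiffAt (U.isOpen.mem_nhds y.2)).of_le
      (WithTop.coe_le_coe.mpr (le_top : (2 : ℕ∞) ≤ ⊤))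
  have hsymm := h2.isSymmSndFDerivAt (by simp)
  have hd : DifferentiableAt ℝ (fderiv ℝ (zeroExtend f.1)) y :=
    (h2.fderiv_right (m := 1) (by norm_num)).differentiableAt (by simp)
  have key : ∀ k l : Fin 4, (D k (D l f)).1 y
      = fderiv ℝ (fderiv ℝ (zeroExtend f.1)) y (basisVec k) (basisVec l) := by
    intro k l
    rw [← partialD_eq (f := D l f) (F := partialD l (zeroExtend f.1)) (fun z => rfl)]
    change fderiv ℝ (fun z => fderiv ℝ (zeroExtend f.1) z (basisVec l)) y (basisVec k) = _
    rw [fderiv_clm_apply hd (differentiableAt_const _)]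
    simp
  rw [key, key]
  exact hsymm _ _

end SmoothFn

end SmoothFunctions

end CConn

namespace CConn

/-! ### Connections, curvature and Bianchi identities over an algebra with derivations -/

section AlgebraicConnections

open Matrix

variable {A : Type*} [CommRing A] [Algebra ℝ A]

theorem eq_zero_of_two_mul {x : A} (h : 2 * x = 0) : x = 0 := by
  have h2 : (2 : ℝ) • x = 0 := by rw [← h, Algebra.smul_def, map_ofNat]
  simpa using h2

/-- Entrywise derivative of a matrix. -/
def matDeriv (δ : Derivation ℝ A A) (X : Matrix (Fin 4) (Fin 4) A) : Matrix (Fin 4) (Fin 4) A :=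
  X.map δ

section MatDeriv

variable (δ : Derivation ℝ A A) (X Y : Matrix (Fin 4) (Fin 4) A)

@[simp] theorem matDeriv_apply (i j : Fin 4) : matDeriv δ X i j = δ (X i j) := rfl

theorem matDeriv_add : matDeriv δ (X + Y) = matDeriv δ X + matDeriv δ Y := by
  ext; simp

theorem matDeriv_sub : matDeriv δ (X - Y) = matDeriv δ X - matDeriv δ Y := by
  ext; simp

theorem matDeriv_mul : matDeriv δ (X * Y) = matDeriv δ X * Y + X * matDeriv δ Y := by
  ext i j
  simp only [matDeriv_apply, Matrix.mul_apply, Matrix.add_apply, map_sum,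
    Derivation.leibniz, smul_eq_mul]
  rw [← Finset.sum_add_distrib]
  exact Finset.sum_congr rfl fun k _ => by ring

theorem matDeriv_transpose : matDeriv δ Xᵀ = (matDeriv δ X)ᵀ := rfl

theorem matDeriv_one : matDeriv δ (1 : Matrix (Fin 4) (Fin 4) A) = 0 := by
  ext i j
  by_cases h : i = j <;> simp [h]

theorem matDeriv_smul (c : A) : matDeriv δ (c • X) = δ c • X + c • matDeriv δ X := by
  ext i j
  simp; ring

theorem matDeriv_sum {ι : Type*} (s : Finset ι) (Z : ι → Matrix (Fin 4) (Fin 4) A) :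
    matDeriv δ (∑ i ∈ s, Z i) = ∑ i ∈ s, matDeriv δ (Z i) := by
  ext i j
  simp [Matrix.sum_apply]

end MatDeriv

variable (D : Fin 4 → Derivation ℝ A A)

/-- Curvature matrices of the connection with matrices `Γ a = (Γ^d_{ac})_{d,c}`: the entry
`(d, c)` of `curv D Γ a b` is `R_{abc}^d`. -/
def curv (Γ : Fin 4 → Matrix (Fin 4) (Fin 4) A) (a b : Fin 4) : Matrix (Fin 4) (Fin 4) A :=
  matDeriv (D b) (Γ a) - matDeriv (D a) (Γ b) + Γ b * Γ a - Γ a * Γ b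

/-- Ricci tensor `R_{abc}^b` of a connection given by matrices. -/
def ric (Γ : Fin 4 → Matrix (Fin 4) (Fin 4) A) (a c : Fin 4) : A :=
  ∑ b, curv D Γ a b b c

theorem curv_antisymm (Γ : Fin 4 → Matrix (Fin 4) (Fin 4) A) (a b : Fin 4) :
    curv D Γ a b = -curv D Γ b a := by
  simp only [curv]; abel

/-- The partial derivatives commute. -/
def CommutingDerivations : Prop := ∀ i j f, D i (D j f) = D j (D i f)

/-- `Γ` is the Levi-Civita connection of the metric `g` with inverse `gi`. -/
structure IsLeviCivita (g gi : Matrix (Fin 4) (Fin 4) A)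
    (Γ : Fin 4 → Matrix (Fin 4) (Fin 4) A) : Prop where
  comm : CommutingDerivations D
  metric_symm : gᵀ = g
  inv_mul : gi * g = 1
  torsion_free : ∀ a c d, Γ a d c = Γ c d a
  compat : ∀ a, matDeriv (D a) g = (Γ a)ᵀ * g + g * Γ a

variable {D}

theorem CommutingDerivations.matDeriv (h : CommutingDerivations D) (i j : Fin 4)
    (X : Matrix (Fin 4) (Fin 4) A) :
    CConn.matDeriv (D i) (CConn.matDeriv (D j) X)
      = CConn.matDeriv (D j) (CConn.matDeriv (D i) X) := by
  ext k l; exact h i j _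

/-- Second Bianchi identity. -/
theorem bianchi_second (h : CommutingDerivations D) (Γ : Fin 4 → Matrix (Fin 4) (Fin 4) A)
    (e a b : Fin 4) :
    (matDeriv (D e) (curv D Γ a b) + Γ e * curv D Γ a b - curv D Γ a b * Γ e)
      + (matDeriv (D a) (curv D Γ b e) + Γ a * curv D Γ b e - curv D Γ b e * Γ a)
      + (matDeriv (D b) (curv D Γ e a) + Γ b * curv D Γ e a - curv D Γ e a * Γ b) = 0 := by
  simp only [curv, matDeriv_add, matDeriv_sub, matDeriv_mul]
  rw [h.matDeriv e b, h.matDeriv a e, h.matDeriv b a]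
  noncomm_ring

/-- First Bianchi identity. -/
theorem bianchi_first {Γ : Fin 4 → Matrix (Fin 4) (Fin 4) A}
    (hΓ : ∀ a c d, Γ a d c = Γ c d a) (a b c d : Fin 4) :
    curv D Γ a b d c + curv D Γ b c d a + curv D Γ c a d b = 0 := by
  simp only [curv, Matrix.sub_apply, Matrix.add_apply, matDeriv_apply, Matrix.mul_apply]
  have h1 : ∀ p q r, ∑ k, Γ p d k * Γ q k r = ∑ k, Γ p d k * Γ r k q := fun p q r =>
    Finset.sum_congr rfl fun k _ => by rw [hΓ q r k]
  rw [hΓ a c d, hΓ b c d, hΓ b a d, h1 b a c, h1 a b c, h1 c b a]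
  ring

variable {g gi : Matrix (Fin 4) (Fin 4) A} {Γ : Fin 4 → Matrix (Fin 4) (Fin 4) A}

namespace IsLeviCivita

theorem mul_inv (h : IsLeviCivita D g gi Γ) : g * gi = 1 := mul_eq_one_comm.mp h.inv_mul

theorem inv_symm (h : IsLeviCivita D g gi Γ) : giᵀ = gi := by
  have h1 : giᵀ * g = 1 := by
    rw [← transpose_one, ← h.mul_inv, transpose_mul, h.metric_symm]
  calc giᵀ = giᵀ * (g * gi) := by rw [h.mul_inv, mul_one]
    _ = gi := by rw [← mul_assoc, h1, one_mul]

/-- Obtained by differentiating `gi * g = 1`; it says that the inverse metric is parallel. -/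
theorem matDeriv_inv (h : IsLeviCivita D g gi Γ) (a : Fin 4) :
    matDeriv (D a) gi = -(gi * (Γ a)ᵀ) - Γ a * gi := by
  have h1 : matDeriv (D a) gi * g + gi * matDeriv (D a) g = 0 := by
    rw [← matDeriv_mul, h.inv_mul, matDeriv_one]
  calc matDeriv (D a) gi = (matDeriv (D a) gi * g + gi * matDeriv (D a) g) * gi
        - gi * matDeriv (D a) g * gi := by
          rw [add_mul, mul_assoc (matDeriv (D a) gi), h.mul_inv, mul_one]; abel
    _ = -(gi * (Γ a)ᵀ * (g * gi)) - (gi * g) * Γ a * gi := by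
          rw [h1, h.compat]; noncomm_ring
    _ = _ := by rw [h.mul_inv, h.inv_mul, mul_one, one_mul]

/-- The integrability condition of `compat`: apply `D b` and `D a` to `g` in both orders and
subtract. -/
theorem curv_skew (h : IsLeviCivita D g gi Γ) (a b : Fin 4) :
    (curv D Γ a b)ᵀ * g + g * curv D Γ a b = 0 := by
  have h1 := h.comm.matDeriv b a g
  simp only [h.compat, matDeriv_add, matDeriv_mul, matDeriv_transpose] at h1
  simp only [curv, transpose_sub, transpose_add, transpose_mul]
  rw [← sub_eq_zero] at h1
  rw [← h1]
  noncomm_ring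

theorem curv_mul_inv_skew (h : IsLeviCivita D g gi Γ) (a b : Fin 4) :
    (curv D Γ a b * gi)ᵀ = -(curv D Γ a b * gi) := by
  rw [transpose_mul, h.inv_symm]
  have h1 := h.curv_skew a b
  calc gi * (curv D Γ a b)ᵀ = gi * ((curv D Γ a b)ᵀ * (g * gi)) := by rw [h.mul_inv, mul_one]
    _ = gi * ((curv D Γ a b)ᵀ * g + g * curv D Γ a b) * gi - (gi * g) * curv D Γ a b * gi := by
      noncomm_ring
    _ = _ := by rw [h1, h.inv_mul]; noncomm_ring

/-- The curvature is a skew matrix times the symmetric matrix `g`, and such a product has trace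
zero. -/
theorem trace_curv (h : IsLeviCivita D g gi Γ) (a b : Fin 4) : ∑ c, curv D Γ a b c c = 0 := by
  apply eq_zero_of_two_mul
  have h1 : (curv D Γ a b).trace = -(curv D Γ a b).trace := by
    calc (curv D Γ a b).trace = (curv D Γ a b * gi * g).trace := by
          rw [mul_assoc, h.inv_mul, mul_one]
      _ = ((curv D Γ a b * gi * g)ᵀ).trace := (trace_transpose _).symm
      _ = -(curv D Γ a b * gi * g).trace := by
          rw [transpose_mul, h.curv_mul_inv_skew, h.metric_symm, trace_mul_comm, neg_mul,
            trace_neg]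
      _ = _ := by rw [mul_assoc, h.inv_mul, mul_one]
  change 2 * (curv D Γ a b).trace = 0
  linear_combination h1

/-- Contract the first Bianchi identity: the third term is the trace of the curvature, which
vanishes for a metric connection. -/
theorem ric_symm (h : IsLeviCivita D g gi Γ) (a c : Fin 4) : ric D Γ a c = ric D Γ c a := by
  have h1 : ∑ b, (curv D Γ a b b c + curv D Γ b c b a + curv D Γ c a b b) = 0 :=
    Finset.sum_eq_zero fun b _ => bianchi_first h.torsion_free a b c b
  simp only [Finset.sum_add_distrib, h.trace_curv, add_zero] at h1
  have h2 : ∑ b, curv D Γ b c b a = -∑ b, curv D Γ c b b a := by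
    rw [← Finset.sum_neg_distrib]
    exact Finset.sum_congr rfl fun b _ => by rw [curv_antisymm D Γ b c]; rfl
  rw [h2] at h1
  simp only [ric]
  linear_combination h1

/-- If the Ricci tensor is a function multiple of the metric, the function is constant. -/
theorem deriv_eq_zero_of_ric_eq (h : IsLeviCivita D g gi Γ) {ρ : A}
    (hρ : ∀ a c, ric D Γ a c = ρ * g a c) (e : Fin 4) : D e ρ = 0 := by
  -- Curvature with its third index raised. Both pairs are then skew, so the second Bianchi identity
  -- can be contracted twice by plain sums.
  let H : Fin 4 → Fin 4 → Matrix (Fin 4) (Fin 4) A := fun a b => curv D Γ a b * gi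
  have hskew : ∀ a b c d, H a b c d = -H a b d c := fun a b c d =>
    congrFun (congrFun (h.curv_mul_inv_skew a b) d) c
  have hanti : ∀ a b c d, H a b c d = -H b a c d := fun a b c d => by
    simp only [H]; rw [curv_antisymm D Γ a b, neg_mul]; rfl
  have hric : ∀ a c, ∑ b, H a b b c = if a = c then ρ else 0 := by
    intro a c
    have : ∑ b, H a b b c = ∑ k, ric D Γ a k * gi k c := by
      simp only [H, Matrix.mul_apply, ric, Finset.sum_mul]
      exact Finset.sum_comm
    rw [this]
    simp only [hρ, mul_assoc, ← Finset.mul_sum]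
    rw [← Matrix.mul_apply, h.mul_inv, Matrix.one_apply]
    simp
  have hric' : ∀ b k, ∑ a, H a b k a = if b = k then ρ else 0 := by
    intro b k
    rw [← hric b k]
    exact Finset.sum_congr rfl fun a _ => by rw [hanti, hskew, neg_neg]
  have hcyc : ∀ a b, (matDeriv (D e) (H a b) + Γ e * H a b + H a b * (Γ e)ᵀ)
      + (matDeriv (D a) (H b e) + Γ a * H b e + H b e * (Γ a)ᵀ)
      + (matDeriv (D b) (H e a) + Γ b * H e a + H e a * (Γ b)ᵀ) = 0 := by
    intro a b
    have h1 := congrArg (· * gi) (bianchi_second h.comm Γ e a b)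
    simp only [zero_mul] at h1
    rw [← h1]
    simp only [H, matDeriv_mul, h.matDeriv_inv]
    noncomm_ring
  -- The double contraction. The derivative terms give `4 - 1 - 1 = 2` times `D e ρ`; the connection
  -- terms either cancel in pairs (`s2`, `s3` against `s6`, `s8`) or vanish (`s5`, `s9`).
  have hsum : ∑ a, ∑ b, ((D e (H a b b a) + ∑ k, Γ e b k * H a b k a + ∑ k, H a b b k * Γ e a k)
      + (D a (H b e b a) + ∑ k, Γ a b k * H b e k a + ∑ k, H b e b k * Γ a a k)
      + (D b (H e a b a) + ∑ k, Γ b b k * H e a k a + ∑ k, H e a b k * Γ b a k)) = 0 :=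
    Finset.sum_eq_zero fun a _ => Finset.sum_eq_zero fun b _ => by
      have := congrFun (congrFun (hcyc a b) b) a
      simpa only [Matrix.add_apply, Matrix.mul_apply, matDeriv_apply, Matrix.transpose_apply,
        Matrix.zero_apply] using this
  have s1 : ∑ a, ∑ b, D e (H a b b a) = 4 * D e ρ := by
    have h4 : D e (4 : A) = 0 := by exact_mod_cast (D e).map_natCast 4
    simp only [← map_sum, hric]
    simp [h4]
  have s2 : ∑ a, ∑ b, ∑ k, Γ e b k * H a b k a = ρ * ∑ k, Γ e k k := by
    rw [Finset.sum_comm, Finset.mul_sum]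
    refine Finset.sum_congr rfl fun b _ => ?_
    rw [Finset.sum_comm]
    simp only [← Finset.mul_sum, hric']
    simp [mul_comm]
  have s3 : ∑ a, ∑ b, ∑ k, H a b b k * Γ e a k = ρ * ∑ k, Γ e k k := by
    rw [Finset.mul_sum]
    refine Finset.sum_congr rfl fun a _ => ?_
    rw [Finset.sum_comm]
    simp only [← Finset.sum_mul, hric]
    simp
  have hric2 : ∀ e a, ∑ b, H b e b a = -if e = a then ρ else 0 := by
    intro e a
    rw [← hric e a, ← Finset.sum_neg_distrib]
    exact Finset.sum_congr rfl fun b _ => hanti _ _ _ _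
  have hric3 : ∀ e b, ∑ a, H e a b a = -if e = b then ρ else 0 := by
    intro e b
    rw [← hric e b, ← Finset.sum_neg_distrib]
    exact Finset.sum_congr rfl fun a _ => hskew _ _ _ _
  have s4 : ∑ a, ∑ b, D a (H b e b a) = -D e ρ := by
    simp only [← map_sum, hric2, map_neg]
    simp [apply_ite]
  have s7 : ∑ a, ∑ b, D b (H e a b a) = -D e ρ := by
    rw [Finset.sum_comm]
    simp only [← map_sum, hric3, map_neg]
    simp [apply_ite]
  -- `Γ a b k` is symmetric and `H b e k a` skew in `a`, `k`; `s9` is of the same kind.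
  have s5 : ∀ b, ∑ a, ∑ k, Γ a b k * H b e k a = 0 := by
    intro b
    apply eq_zero_of_two_mul
    rw [two_mul]
    nth_rewrite 2 [Finset.sum_comm]
    rw [← Finset.sum_add_distrib]
    refine Finset.sum_eq_zero fun a _ => ?_
    rw [← Finset.sum_add_distrib]
    refine Finset.sum_eq_zero fun k _ => ?_
    rw [h.torsion_free a k b, hskew]; ring
  have s9 : ∀ a, ∑ b, ∑ k, H e a b k * Γ b a k = 0 := by
    intro a
    apply eq_zero_of_two_mul
    rw [two_mul]
    nth_rewrite 2 [Finset.sum_comm]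
    rw [← Finset.sum_add_distrib]
    refine Finset.sum_eq_zero fun b _ => ?_
    rw [← Finset.sum_add_distrib]
    refine Finset.sum_eq_zero fun k _ => ?_
    rw [h.torsion_free b k a, hskew]; ring
  have s6 : ∑ a, ∑ b, ∑ k, H b e b k * Γ a a k = -(ρ * ∑ k, Γ e k k) := by
    rw [Finset.mul_sum, ← Finset.sum_neg_distrib]
    refine Finset.sum_congr rfl fun a _ => ?_
    rw [Finset.sum_comm]
    simp only [← Finset.sum_mul, hric2]
    simp [h.torsion_free a e]
  have s8 : ∑ a, ∑ b, ∑ k, Γ b b k * H e a k a = -(ρ * ∑ k, Γ e k k) := by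
    rw [Finset.sum_comm, Finset.mul_sum, ← Finset.sum_neg_distrib]
    refine Finset.sum_congr rfl fun b _ => ?_
    rw [Finset.sum_comm]
    simp only [← Finset.mul_sum, hric3]
    simp [h.torsion_free b e, mul_comm]
  simp only [Finset.sum_add_distrib] at hsum
  have s5' : ∑ a, ∑ b, ∑ k, Γ a b k * H b e k a = 0 := by
    rw [Finset.sum_comm]; exact Finset.sum_eq_zero fun b _ => s5 b
  have s9' : ∑ a, ∑ b, ∑ k, H e a b k * Γ b a k = 0 := Finset.sum_eq_zero fun a _ => s9 a
  rw [s1, s2, s3, s4, s5', s6, s7, s8, s9'] at hsum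
  apply eq_zero_of_two_mul
  linear_combination hsum

end IsLeviCivita

end AlgebraicConnections

end CConn

namespace CConn

/-! ### Levi-Civita connection and Ricci tensor under conformal change -/

section ConformalChange

open Matrix

variable {A : Type*} [CommRing A] [Algebra ℝ A] {D : Fin 4 → Derivation ℝ A A}
  {g gi : Matrix (Fin 4) (Fin 4) A} {Γ : Fin 4 → Matrix (Fin 4) (Fin 4) A}

/-- The Levi-Civita connection matrices of a metric. -/
def leviCivita (D : Fin 4 → Derivation ℝ A A) (g gi : Matrix (Fin 4) (Fin 4) A) (a : Fin 4) :
    Matrix (Fin 4) (Fin 4) A :=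
  Matrix.of fun c b => algebraMap ℝ A (1 / 2) *
    ∑ d, gi c d * (D a (g d b) + D b (g d a) - D d (g a b))

theorem two_mul_half : (2 : A) * algebraMap ℝ A (1 / 2) = 1 := by
  rw [← map_ofNat (algebraMap ℝ A) 2, ← map_mul]; norm_num

theorem isLeviCivita_leviCivita (hD : CommutingDerivations D) (hg : gᵀ = g) (hgi : gi * g = 1) :
    IsLeviCivita D g gi (leviCivita D g gi) := by
  have hs : ∀ a b, g a b = g b a := fun a b => congrFun (congrFun hg b) a
  refine ⟨hD, hg, hgi, fun a c d => ?_, fun a => ?_⟩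
  · simp only [leviCivita, Matrix.of_apply]
    congr 1
    refine Finset.sum_congr rfl fun k _ => ?_
    rw [hs a c]; ring
  · have hmul : g * gi = 1 := mul_eq_one_comm.mp hgi
    have key : ∀ b c, (g * leviCivita D g gi a) b c
        = algebraMap ℝ A (1 / 2) * (D a (g b c) + D c (g b a) - D b (g a c)) := by
      intro b c
      have : leviCivita D g gi a
          = gi * Matrix.of fun d c => algebraMap ℝ A (1 / 2)
              * (D a (g d c) + D c (g d a) - D d (g a c)) := by
        ext p q
        simp only [leviCivita, Matrix.of_apply, Matrix.mul_apply, Finset.mul_sum]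
        exact Finset.sum_congr rfl fun _ _ => by ring
      rw [this, ← mul_assoc, hmul, one_mul, Matrix.of_apply]
    have htr : (leviCivita D g gi a)ᵀ * g = (g * leviCivita D g gi a)ᵀ := by
      rw [transpose_mul, hg]
    ext b c
    rw [htr, Matrix.add_apply, Matrix.transpose_apply, key, key, matDeriv_apply, hs c b, hs b a,
      hs c a]
    linear_combination (-(D a (g b c))) * two_mul_half (A := A)

/-- Koszul's argument: in the cyclic combination of the compatibility equations, torsion-freeness
leaves only twice `g * Γ a`. -/
theorem IsLeviCivita.eq_leviCivita (h : IsLeviCivita D g gi Γ) : Γ = leviCivita D g gi := by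
  funext a
  have hlow : ∀ a b c, (g * Γ a) b c = (g * Γ c) b a := fun a b c => by
    simp only [Matrix.mul_apply]
    exact Finset.sum_congr rfl fun k _ => by rw [h.torsion_free a c k]
  have hc : ∀ a b c, D a (g b c) = (g * Γ a) c b + (g * Γ a) b c := fun a b c => by
    have h1 := congrFun (congrFun (h.compat a) b) c
    have htr : (Γ a)ᵀ * g = (g * Γ a)ᵀ := by rw [transpose_mul, h.metric_symm]
    rwa [htr] at h1
  have h2 : g * Γ a = Matrix.of fun d c => algebraMap ℝ A (1 / 2)
      * (D a (g d c) + D c (g d a) - D d (g a c)) := by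
    ext d c
    rw [Matrix.of_apply, hc, hc, hc, hlow c d a, hlow d c a, hlow d a c, hlow c a d]
    linear_combination (-((g * Γ a) d c)) * two_mul_half (A := A)
  calc Γ a = gi * (g * Γ a) := by rw [← mul_assoc, h.inv_mul, one_mul]
    _ = _ := by
      rw [h2]
      ext p q
      simp only [leviCivita, Matrix.of_apply, Matrix.mul_apply, Finset.mul_sum]
      exact Finset.sum_congr rfl fun _ _ => by ring

/-- Index raising. -/
def raise {R : Type*} [CommRing R] (gi : Matrix (Fin 4) (Fin 4) R) (u : Fin 4 → R) (d : Fin 4) :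
    R := ∑ e, gi d e * u e

/-- The tensor `g^{cd} g_{ab} u_d - δ_b^c u_a - δ_a^c u_b`, as matrices. -/
def weylShift {A : Type*} [CommRing A] (g gi : Matrix (Fin 4) (Fin 4) A) (u : Fin 4 → A) (a : Fin 4) :
    Matrix (Fin 4) (Fin 4) A :=
  Matrix.of fun d c => g a c * raise gi u d - (if d = c then u a else 0) - (if d = a then u c else 0)

/-- Covariant derivative of a covector. -/
def nabla (D : Fin 4 → Derivation ℝ A A) (Γ : Fin 4 → Matrix (Fin 4) (Fin 4) A) (u : Fin 4 → A)
    (a c : Fin 4) : A := D a (u c) - ∑ e, Γ a e c * u e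

/-- Divergence of a vector. -/
def divergence (D : Fin 4 → Derivation ℝ A A) (Γ : Fin 4 → Matrix (Fin 4) (Fin 4) A)
    (v : Fin 4 → A) : A := ∑ d, D d (v d) + ∑ e, (∑ b, Γ b b e) * v e

theorem sum_lower_raise {R : Type*} [CommRing R] {g gi : Matrix (Fin 4) (Fin 4) R}
    (hmul : g * gi = 1) (u : Fin 4 → R) (a : Fin 4) :
    ∑ d, g a d * raise gi u d = u a := by
  have : g *ᵥ (gi *ᵥ u) = u := by rw [mulVec_mulVec, hmul, one_mulVec]
  exact congrFun this a

/-- With its upper index lowered, the shift is `g_{ac} u_b - g_{bc} u_a - g_{ba} u_c`; symmetrizing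
in `b`, `c` cancels everything except `-2 u_a g_{bc}`. -/
theorem weylShift_compat {A : Type*} [CommRing A] {g gi : Matrix (Fin 4) (Fin 4) A}
    (hg : gᵀ = g) (hmul : g * gi = 1) (u : Fin 4 → A) (a : Fin 4) :
    (weylShift g gi u a)ᵀ * g + g * weylShift g gi u a = (-2 * u a) • g := by
  have hs : ∀ a b, g a b = g b a := fun a b => congrFun (congrFun hg b) a
  have key : ∀ b c, (g * weylShift g gi u a) b c = g a c * u b - g b c * u a - g b a * u c := by
    intro b c
    simp only [Matrix.mul_apply, weylShift, Matrix.of_apply, mul_sub, Finset.sum_sub_distrib]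
    have h1 : ∑ d, g b d * (g a c * raise gi u d) = g a c * u b := by
      rw [← sum_lower_raise hmul u b, Finset.mul_sum]
      exact Finset.sum_congr rfl fun _ _ => by ring
    rw [h1]; simp
  have htr : (weylShift g gi u a)ᵀ * g = (g * weylShift g gi u a)ᵀ := by
    rw [transpose_mul, hg]
  ext b c
  rw [htr, Matrix.add_apply, Matrix.transpose_apply, key, key, hs c b, hs b a, hs c a]
  simp; ring

/-- The shifted connection is the Levi-Civita connection of a conformally related metric. -/
theorem IsLeviCivita.conformal (h : IsLeviCivita D g gi Γ) {u : Fin 4 → A} {τ τi : A}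
    (hτ : τi * τ = 1) (hu : ∀ a, D a τ = -2 * u a * τ) :
    IsLeviCivita D (τ • g) (τi • gi) (Γ + weylShift g gi u) := by
  have hs : ∀ a b, g a b = g b a := fun a b => congrFun (congrFun h.metric_symm b) a
  refine ⟨h.comm, by rw [transpose_smul, h.metric_symm], ?_, fun a c d => ?_, fun a => ?_⟩
  · rw [smul_mul_smul_comm, hτ, h.inv_mul, one_smul]
  · simp only [Pi.add_apply, Matrix.add_apply, weylShift, Matrix.of_apply]
    rw [h.torsion_free a c d, hs a c]; ring
  · have h1 := weylShift_compat h.metric_symm h.mul_inv u a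
    rw [matDeriv_smul, h.compat, Pi.add_apply, transpose_add, add_mul, mul_add]
    simp only [Matrix.mul_smul, Matrix.smul_mul]
    have h2 : D a τ • g = τ • ((weylShift g gi u a)ᵀ * g + g * weylShift g gi u a) := by
      rw [h1, smul_smul, hu]; congr 1; ring
    rw [h2]
    simp only [smul_add]
    abel

/-- As `g` is parallel, covariant differentiation commutes with lowering an index. -/
theorem IsLeviCivita.sum_nabla (h : IsLeviCivita D g gi Γ) (u : Fin 4 → A) (a c : Fin 4) :
    nabla D Γ u a c
      = ∑ d, g c d * (D a (raise gi u d) + ∑ k, Γ a d k * raise gi u k) := by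
  have h1 : D a (u c) = ∑ d, (D a (g c d) * raise gi u d + g c d * D a (raise gi u d)) := by
    conv_lhs => rw [← sum_lower_raise h.mul_inv u c]
    rw [map_sum]
    exact Finset.sum_congr rfl fun _ _ => by rw [Derivation.leibniz]; simp; ring
  have hc : ∀ d, D a (g c d) = ∑ e, Γ a e c * g e d + ∑ e, g c e * Γ a e d := fun d =>
    congrFun (congrFun (h.compat a) c) d
  have h2 : ∑ e, Γ a e c * u e = ∑ d, ∑ e, Γ a e c * g e d * raise gi u d := by
    rw [Finset.sum_comm]
    refine Finset.sum_congr rfl fun e _ => ?_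
    rw [← sum_lower_raise h.mul_inv u e, Finset.mul_sum]
    exact Finset.sum_congr rfl fun _ _ => by ring
  have h3 : ∑ d, g c d * ∑ k, Γ a d k * raise gi u k
      = ∑ d, ∑ e, g c e * Γ a e d * raise gi u d := by
    rw [Finset.sum_comm]
    refine Finset.sum_congr rfl fun e _ => ?_
    rw [Finset.mul_sum]
    exact Finset.sum_congr rfl fun _ _ => by ring
  simp only [nabla, h1, h2, mul_add, Finset.sum_add_distrib, h3, hc, add_mul, Finset.sum_mul]
  ring

theorem IsLeviCivita.sum_inv_mul_nabla (h : IsLeviCivita D g gi Γ) (u : Fin 4 → A) :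
    ∑ a, ∑ c, gi a c * nabla D Γ u a c = divergence D Γ (raise gi u) := by
  have h1 : ∀ a, ∑ c, gi a c * nabla D Γ u a c
      = D a (raise gi u a) + ∑ k, Γ a a k * raise gi u k := by
    intro a
    simp only [h.sum_nabla]
    have h2 : gi *ᵥ (g *ᵥ fun d => (D a (raise gi u d) + ∑ k, Γ a d k * raise gi u k))
        = fun d => (D a (raise gi u d) + ∑ k, Γ a d k * raise gi u k) := by
      rw [mulVec_mulVec, h.inv_mul, one_mulVec]
    exact congrFun h2 a
  simp only [h1, Finset.sum_add_distrib, divergence, Finset.sum_mul]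
  rw [Finset.sum_comm (f := fun a k => Γ a a k * raise gi u k)]

/-- Ricci tensor of the shifted connection. -/
theorem IsLeviCivita.ric_add_weylShift (h : IsLeviCivita D g gi Γ) {u : Fin 4 → A}
    (hu : ∀ a b, D a (u b) = D b (u a)) (a c : Fin 4) :
    ric D (Γ + weylShift g gi u) a c = ric D Γ a c + 2 * nabla D Γ u a c + 2 * u a * u c
      + g a c * (divergence D Γ (raise gi u) - 2 * ∑ e, u e * raise gi u e) := by
  have hs : ∀ a b, g a b = g b a := fun a b => congrFun (congrFun h.metric_symm b) a
  have hlow := sum_lower_raise h.mul_inv u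
  set S := weylShift g gi u
  set v := raise gi u
  have hSe : ∀ a d c, S a d c
      = g a c * v d - (if d = c then u a else 0) - (if d = a then u c else 0) := fun _ _ _ => rfl
  have hstr : ∀ e, ∑ b, S b b e = -4 * u e := by
    intro e
    have h1 : ∑ b, g b e * v b = u e := by rw [← hlow e]; simp only [hs e]
    simp only [hSe, Finset.sum_sub_distrib, h1]
    simp
  -- Curvature is quadratic in the connection. The `Γ`-`S` terms `t3`, `t4`, `t6`, `t7` complete the
  -- derivatives of `S` to covariant ones, and the `S`-`S` terms `t5`, `t8` give the part quadratic
  -- in `u`.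
  have hexp : ric D (Γ + S) a c = ric D Γ a c + ∑ b, D b (S a b c) - D a (∑ b, S b b c)
      + ∑ b, ∑ e, Γ b b e * S a e c + ∑ b, ∑ e, S b b e * Γ a e c + ∑ b, ∑ e, S b b e * S a e c
      - ∑ b, ∑ e, Γ a b e * S b e c - ∑ b, ∑ e, S a b e * Γ b e c
      - ∑ b, ∑ e, S a b e * S b e c := by
    simp only [ric, curv, Matrix.sub_apply, Matrix.add_apply, Pi.add_apply, matDeriv_add,
      matDeriv_apply, Matrix.mul_apply, add_mul, mul_add, Finset.sum_add_distrib,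
      Finset.sum_sub_distrib, map_sum]
    ring
  have t1 : ∑ b, D b (S a b c)
      = ∑ b, D b (g a c) * v b + g a c * ∑ b, D b (v b) - D c (u a) - D a (u c) := by
    simp only [hSe, map_sub, Finset.sum_sub_distrib, Derivation.leibniz, smul_eq_mul,
      Finset.sum_add_distrib, ← Finset.mul_sum, apply_ite (D _), map_zero]
    simp [mul_comm]; ring
  have t3 : ∑ b, ∑ e, Γ b b e * S a e c = g a c * ∑ e, (∑ b, Γ b b e) * v e
      - (∑ b, Γ b b c) * u a - (∑ b, Γ b b a) * u c := by
    rw [Finset.sum_comm]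
    simp only [← Finset.sum_mul, hSe, mul_sub, Finset.sum_sub_distrib, Finset.mul_sum]
    congr 2
    · exact Finset.sum_congr rfl fun _ _ => by ring
    · simp
    · simp
  have t4 : ∑ b, ∑ e, S b b e * Γ a e c = -4 * ∑ e, Γ a e c * u e := by
    rw [Finset.sum_comm]
    simp only [← Finset.sum_mul, hstr, Finset.mul_sum]
    exact Finset.sum_congr rfl fun _ _ => by ring
  have t5 : ∑ b, ∑ e, S b b e * S a e c = -4 * (g a c * ∑ e, u e * v e - 2 * u a * u c) := by
    rw [Finset.sum_comm]
    simp only [← Finset.sum_mul, hstr]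
    simp only [hSe, mul_sub, Finset.sum_sub_distrib, Finset.mul_sum]
    have : ∑ e, -4 * u e * (g a c * v e) = ∑ e, -4 * (g a c * (u e * v e)) :=
      Finset.sum_congr rfl fun _ _ => by ring
    rw [this]
    simp; ring
  have t6 : ∑ b, ∑ e, Γ a b e * S b e c = ∑ b, ∑ e, Γ a b e * g b c * v e
      - ∑ e, Γ a e c * u e - u c * ∑ b, Γ a b b := by
    simp only [hSe, mul_sub, Finset.sum_sub_distrib, Finset.mul_sum]
    congr 2
    · exact Finset.sum_congr rfl fun _ _ => Finset.sum_congr rfl fun _ _ => by ring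
    · simp
    · simp [mul_comm]
  have t7 : ∑ b, ∑ e, S a b e * Γ b e c = ∑ b, ∑ e, g a e * Γ b e c * v b
      - u a * ∑ b, Γ b b c - ∑ e, Γ a e c * u e := by
    simp only [hSe, sub_mul, Finset.sum_sub_distrib, Finset.mul_sum]
    have h1 : ∑ b, ∑ e, (if b = a then u e else 0) * Γ b e c = ∑ e, Γ a e c * u e := by
      rw [Finset.sum_comm]; simp [mul_comm]
    rw [h1]
    congr 2
    · exact Finset.sum_congr rfl fun _ _ => Finset.sum_congr rfl fun _ _ => by ring
    · simp
  have t8 : ∑ b, ∑ e, S a b e * S b e c = 6 * u a * u c - 2 * g a c * ∑ e, u e * v e := by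
    have h1 : ∀ b, ∑ e, S a b e * S b e c
        = g b c * v b * u a - g a c * (u b * v b) - g a b * v b * u c
          - (g b c * v b * u a - (if b = c then u a * u b else 0) - u a * u c)
          - (if b = a then g b c * ∑ e, u e * v e - u b * u c - u b * u c else 0) := by
      intro b
      simp only [hSe, sub_mul, mul_sub, Finset.sum_sub_distrib]
      have e1 : ∑ e, g a e * v b * (g b c * v e) = g b c * v b * u a := by
        rw [← hlow a, Finset.mul_sum]
        exact Finset.sum_congr rfl fun _ _ => by ring
      rw [e1]
      by_cases hba : b = a
      · subst hba
        have e2 : ∑ e, u e * (g b c * v e) = g b c * ∑ e, u e * v e := by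
          rw [Finset.mul_sum]; exact Finset.sum_congr rfl fun _ _ => by ring
        by_cases hbc : b = c
        · subst hbc; simp [e2]; ring
        · simp [e2, hbc]; ring
      · by_cases hbc : b = c
        · subst hbc; simp [hba]; ring
        · simp [hba, hbc]; ring
    have e3 : ∑ b, g b c * v b * u a = u c * u a := by
      rw [← Finset.sum_mul, ← hlow c]; simp only [hs c]
    have e4 : ∑ b, g a b * v b * u c = u a * u c := by rw [← Finset.sum_mul, hlow]
    simp only [h1, Finset.sum_sub_distrib, e3, e4, ← Finset.mul_sum]
    simp; ring
  have hcomp : ∑ b, D b (g a c) * v b = ∑ b, ∑ e, Γ a b e * g b c * v e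
      + ∑ b, ∑ e, g a e * Γ b e c * v b := by
    have hc : ∀ b, D b (g a c) = ∑ e, Γ b e a * g e c + ∑ e, g a e * Γ b e c := fun b =>
      congrFun (congrFun (h.compat b) a) c
    simp only [hc, add_mul, Finset.sum_add_distrib, Finset.sum_mul]
    congr 1
    rw [Finset.sum_comm]
    exact Finset.sum_congr rfl fun e _ => Finset.sum_congr rfl fun b _ => by
      rw [h.torsion_free b a e]
  have hT : ∑ b, Γ a b b = ∑ b, Γ b b a := Finset.sum_congr rfl fun b _ => h.torsion_free a b b
  have h4 : D a (4 : A) = 0 := by exact_mod_cast (D a).map_natCast 4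
  have t2 : D a (-4 * u c) = -4 * D a (u c) := by
    rw [Derivation.leibniz, map_neg, h4]; simp
  rw [hexp, t1, hstr, t2, t3, t4, t5, t6, t7, t8, hcomp, hT, hu c a]
  simp only [nabla, divergence]
  ring

end ConformalChange

end CConn

namespace CConn

/-! ### The skew part of the Ricci tensor -/

section SkewRicci

open Matrix

variable {A : Type*} [CommRing A] [Algebra ℝ A] {D : Fin 4 → Derivation ℝ A A}
  {g gi : Matrix (Fin 4) (Fin 4) A} {Γ : Fin 4 → Matrix (Fin 4) (Fin 4) A}

/-- In the contracted first Bianchi identity the third term is the trace of the curvature.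
Commutators have no trace, so only the curl of the traces of `Γ` remains. -/
theorem ric_sub_ric (hΓ : ∀ a c d, Γ a d c = Γ c d a) (a c : Fin 4) :
    ric D Γ a c - ric D Γ c a = D c (Γ a).trace - D a (Γ c).trace := by
  have h1 : ∑ b, (curv D Γ a b b c + curv D Γ b c b a + curv D Γ c a b b) = 0 :=
    Finset.sum_eq_zero fun b _ => bianchi_first hΓ a b c b
  have h2 : ∑ b, curv D Γ b c b a = -∑ b, curv D Γ c b b a := by
    rw [← Finset.sum_neg_distrib]
    exact Finset.sum_congr rfl fun b _ => by rw [curv_antisymm D Γ b c]; rfl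
  have h3 : ∑ b, curv D Γ c a b b = D a (Γ c).trace - D c (Γ a).trace := by
    have : (curv D Γ c a).trace = D a (Γ c).trace - D c (Γ a).trace := by
      rw [curv, add_sub_assoc, trace_add, trace_sub, trace_sub, trace_mul_comm (Γ a), sub_self,
        add_zero]
      simp only [trace, diag_apply, matDeriv_apply, map_sum]
    exact this
  simp only [Finset.sum_add_distrib, h2, h3] at h1
  simp only [ric]
  linear_combination h1

theorem trace_weylShift {A : Type*} [CommRing A] {g gi : Matrix (Fin 4) (Fin 4) A}
    (hmul : g * gi = 1) (u : Fin 4 → A) (a : Fin 4) : (weylShift g gi u a).trace = -4 * u a := by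
  simp only [trace, diag_apply, weylShift, Matrix.of_apply, Finset.sum_sub_distrib,
    sum_lower_raise hmul u a]
  simp

/-- If the Ricci tensor of the shifted connection is symmetric, the covector is closed. -/
theorem IsLeviCivita.closed_of_ric_symm (h : IsLeviCivita D g gi Γ) {u : Fin 4 → A}
    (hs : ∀ a b, ric D (Γ + weylShift g gi u) a b = ric D (Γ + weylShift g gi u) b a)
    (a b : Fin 4) : D a (u b) = D b (u a) := by
  have hsym : ∀ a b, g a b = g b a := fun a b => congrFun (congrFun h.metric_symm b) a
  have htf : ∀ a c d, (Γ + weylShift g gi u) a d c = (Γ + weylShift g gi u) c d a :=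
    fun a c d => by
      simp only [Pi.add_apply, Matrix.add_apply, weylShift, Matrix.of_apply]
      rw [h.torsion_free a c d, hsym a c]; ring
  have h1 := ric_sub_ric (D := D) htf a b
  have h2 := ric_sub_ric (D := D) h.torsion_free a b
  have h4 : ∀ i (f : A), D i (-4 * f) = -4 * D i f := fun i f => by
    have : (-4 : A) * f = (-4 : ℝ) • f := by
      rw [Algebra.smul_def]; simp [map_ofNat]
    rw [this, Derivation.map_smul, Algebra.smul_def]; simp [map_ofNat]
  rw [h.ric_symm a b, sub_self] at h2
  rw [hs a b, sub_self, Pi.add_apply, Pi.add_apply, trace_add, trace_add, map_add, map_add,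
    trace_weylShift h.mul_inv, trace_weylShift h.mul_inv, h4, h4] at h1
  -- The trace of the shift is `-4 u`, so symmetry of both Ricci tensors kills four times the curl
  -- of `u`; the factor is removed as `2 * 2`.
  have h5 : 2 * (2 * (D a (u b) - D b (u a))) = 0 := by linear_combination h2 - h1
  exact sub_eq_zero.mp (eq_zero_of_two_mul (eq_zero_of_two_mul h5))

end SkewRicci

/-! ### The Cotton tensor of a metric conformal to an Einstein metric -/

section Cotton

open Matrix

variable {A : Type*} [CommRing A] [Algebra ℝ A] {D : Fin 4 → Derivation ℝ A A}
  {g gi : Matrix (Fin 4) (Fin 4) A} {Γ : Fin 4 → Matrix (Fin 4) (Fin 4) A}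

/-- Covariant derivative `∇_m X_{pa}` of a covariant two-tensor. -/
def nabla₂ (D : Fin 4 → Derivation ℝ A A) (Γ : Fin 4 → Matrix (Fin 4) (Fin 4) A)
    (X : Fin 4 → Fin 4 → A) (m p a : Fin 4) : A :=
  D m (X p a) - ∑ e, (Γ m e p * X e a + Γ m e a * X p e)

/-- The tensor `R_{abc}^d - 2 L^d_{[b} g_{a]c} - 2 δ^d_{[b} L_{a]c}`. -/
def weylOf (D : Fin 4 → Derivation ℝ A A) (g gi : Matrix (Fin 4) (Fin 4) A)
    (Γ : Fin 4 → Matrix (Fin 4) (Fin 4) A) (L : Fin 4 → Fin 4 → A) (a b c d : Fin 4) : A :=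
  curv D Γ a b d c
    - ((∑ e, gi d e * L e b) * g a c - (∑ e, gi d e * L e a) * g b c)
    - ((if d = b then 1 else 0) * L a c - (if d = a then 1 else 0) * L b c)

theorem IsLeviCivita.nabla_symm (h : IsLeviCivita D g gi Γ) {u : Fin 4 → A}
    (hu : ∀ a b, D a (u b) = D b (u a)) (a b : Fin 4) : nabla D Γ u a b = nabla D Γ u b a := by
  simp only [nabla, hu a b]
  congr 1
  exact Finset.sum_congr rfl fun e _ => by rw [h.torsion_free a b e]

/-- Ricci identity. -/
theorem IsLeviCivita.nabla₂_nabla_antisymm (h : IsLeviCivita D g gi Γ) (u : Fin 4 → A)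
    (m p a : Fin 4) : nabla₂ D Γ (nabla D Γ u) m p a - nabla₂ D Γ (nabla D Γ u) p m a
      = ∑ d, curv D Γ m p d a * u d := by
  have h1 : ∑ e, Γ m e p * nabla D Γ u e a = ∑ e, Γ p e m * nabla D Γ u e a :=
    Finset.sum_congr rfl fun e _ => by rw [h.torsion_free m p e]
  have h2 : ∀ m p, ∑ e, Γ m e a * nabla D Γ u p e
      = ∑ e, Γ m e a * D p (u e) - ∑ d, (∑ e, Γ p d e * Γ m e a) * u d := by
    intro m p
    simp only [nabla, mul_sub, Finset.sum_sub_distrib, Finset.mul_sum, Finset.sum_mul]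
    congr 1
    rw [Finset.sum_comm]
    exact Finset.sum_congr rfl fun _ _ => Finset.sum_congr rfl fun _ _ => by ring
  have h3 : ∀ m p, D m (nabla D Γ u p a) = D m (D p (u a))
      - ∑ e, D m (Γ p e a) * u e - ∑ e, Γ p e a * D m (u e) := by
    intro m p
    simp only [nabla, map_sub, map_sum, Derivation.leibniz, smul_eq_mul, Finset.sum_add_distrib]
    simp only [mul_comm (u _)]
    ring
  simp only [nabla₂, Finset.sum_add_distrib, h1, h2, h3, h.comm m p (u a), curv, Matrix.add_apply,
    Matrix.sub_apply, matDeriv_apply, Matrix.mul_apply, add_mul, sub_mul, Finset.sum_sub_distrib]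
  ring

/-- Leibniz rule for `g^{ab} u_a u_b`, the metric being parallel. -/
theorem IsLeviCivita.deriv_sum_mul_raise (h : IsLeviCivita D g gi Γ) (u : Fin 4 → A) (m : Fin 4) :
    D m (∑ e, u e * raise gi u e) = 2 * ∑ e, raise gi u e * nabla D Γ u m e := by
  set v := raise gi u
  have hs : ∀ a b, g a b = g b a := fun a b => congrFun (congrFun h.metric_symm b) a
  have h1 : ∑ e, v e * nabla D Γ u m e = ∑ d, u d * (D m (v d) + ∑ k, Γ m d k * v k) := by
    simp only [h.sum_nabla, Finset.mul_sum]
    rw [Finset.sum_comm]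
    refine Finset.sum_congr rfl fun d _ => ?_
    rw [← sum_lower_raise h.mul_inv u d, Finset.sum_mul]
    refine Finset.sum_congr rfl fun e _ => ?_
    rw [hs d e]; ring
  have h2 : ∑ e, v e * nabla D Γ u m e = ∑ e, v e * D m (u e) - ∑ e, ∑ k, u k * (Γ m k e * v e) := by
    simp only [nabla, mul_sub, Finset.sum_sub_distrib, Finset.mul_sum]
    congr 1
    exact Finset.sum_congr rfl fun _ _ => Finset.sum_congr rfl fun _ _ => by ring
  have h3 : D m (∑ e, u e * v e) = ∑ e, u e * D m (v e) + ∑ e, v e * D m (u e) := by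
    simp only [map_sum, Derivation.leibniz, smul_eq_mul, Finset.sum_add_distrib]
  rw [two_mul]
  nth_rewrite 1 [h1]
  rw [h2, h3]
  simp only [mul_add, Finset.sum_add_distrib, Finset.mul_sum]
  rw [Finset.sum_comm (f := fun e k => u k * (Γ m k e * v e))]
  ring

/-- If the Schouten tensor has the form it takes for a metric conformal to an Einstein metric, the
Cotton tensor is the contraction of the Weyl tensor with the gradient of the conformal factor. -/
theorem IsLeviCivita.cotton_eq (h : IsLeviCivita D g gi Γ) {u : Fin 4 → A}
    (hu : ∀ a b, D a (u b) = D b (u a)) {L : Fin 4 → Fin 4 → A} {q K : A}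
    (hL : ∀ a b, L a b = -nabla D Γ u a b - u a * u b + q * g a b)
    (hq : ∀ m, D m q = ∑ e, raise gi u e * nabla D Γ u m e - 2 * u m * K)
    (hqK : 2 * q = ∑ e, u e * raise gi u e + 2 * K) (m p a : Fin 4) :
    nabla₂ D Γ L m p a - nabla₂ D Γ L p m a = -∑ d, weylOf D g gi Γ L m p a d * u d := by
  have hs : ∀ a b, g a b = g b a := fun a b => congrFun (congrFun h.metric_symm b) a
  have hgis : ∀ a b, gi a b = gi b a := fun a b => congrFun (congrFun h.inv_symm b) a
  have hlow := sum_lower_raise h.mul_inv u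
  have hnab := h.nabla_symm hu
  set N := nabla D Γ u with hN
  set v := raise gi u with hv
  have hLs : ∀ a b, L a b = L b a := fun a b => by rw [hL, hL, hnab a b, hs a b]; ring
  have hric := h.nabla₂_nabla_antisymm u m p a
  -- Since `∇g = 0`, the term `q g` contributes only `dq`.
  have hsplit : ∀ m p, nabla₂ D Γ L m p a = -nabla₂ D Γ N m p a
      - (N m p * u a + u p * N m a) + D m q * g p a := by
    intro m p
    have hc : D m (g p a) = ∑ e, Γ m e p * g e a + ∑ e, g p e * Γ m e a :=
      congrFun (congrFun (h.compat m) p) a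
    have e1 : ∑ e, (Γ m e p * L e a + Γ m e a * L p e)
        = -∑ e, (Γ m e p * N e a + Γ m e a * N p e) - (∑ e, Γ m e p * u e) * u a
          - u p * (∑ e, Γ m e a * u e) + q * (∑ e, Γ m e p * g e a + ∑ e, g p e * Γ m e a) := by
      simp only [hL, Finset.sum_mul, Finset.mul_sum, ← Finset.sum_add_distrib,
        ← Finset.sum_sub_distrib, ← Finset.sum_neg_distrib]
      exact Finset.sum_congr rfl fun _ _ => by ring
    simp only [nabla₂]
    rw [e1, hL]
    simp only [map_sub, map_add, map_neg, Derivation.leibniz, smul_eq_mul, hc]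
    simp only [hN, nabla]
    ring
  -- Replacing `∇u` by `L` in the contraction with `u` produces the Schouten terms that complete the
  -- curvature to the Weyl tensor.
  have hNv : ∀ m, ∑ e, v e * N m e = -∑ e, v e * L m e - u m * ∑ e, u e * v e + q * u m := by
    intro m
    have : ∀ e, v e * N m e = -(v e * L m e) - u m * (u e * v e) + q * (g m e * v e) := fun e => by
      rw [hL]; ring
    simp only [this, Finset.sum_add_distrib, Finset.sum_sub_distrib, Finset.sum_neg_distrib,
      ← Finset.mul_sum, hlow]
  have hup : ∀ p, ∑ d, (∑ e, gi d e * L e p) * u d = ∑ e, v e * L p e := by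
    intro p
    simp only [Finset.sum_mul]
    rw [Finset.sum_comm]
    refine Finset.sum_congr rfl fun e _ => ?_
    rw [hv, raise, Finset.sum_mul]
    exact Finset.sum_congr rfl fun d _ => by rw [hgis d e, hLs e p]; ring
  have hW : ∑ d, weylOf D g gi Γ L m p a d * u d = ∑ d, curv D Γ m p d a * u d
      - ((∑ e, v e * L p e) * g m a - (∑ e, v e * L m e) * g p a)
      - (u p * L m a - u m * L p a) := by
    rw [← hup, ← hup]
    simp only [weylOf, sub_mul, Finset.sum_sub_distrib, Finset.sum_mul]
    congr 1
    · congr 1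
      congr 1 <;>
      exact Finset.sum_congr rfl fun _ _ => Finset.sum_congr rfl fun _ _ => by ring
    · simp [mul_comm]
  rw [hW, hsplit, hsplit, hq, hq, hNv, hNv, hL m a, hL p a, hnab p m]
  linear_combination (-1 : A) * hric + (u m * g p a - u p * g m a) * hqK

theorem six_mul_sixth : (6 : A) * algebraMap ℝ A (1 / 6) = 1 := by
  rw [← map_ofNat (algebraMap ℝ A) 6, ← map_mul]; norm_num

/-- The Einstein equation for `τ g`, inserted into the transformation law of the Ricci tensor,
determines `ric D Γ`, then its trace, and so puts `L` in the form needed by `cotton_eq`. -/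
theorem IsLeviCivita.cotton_eq_of_ric_eq (h : IsLeviCivita D g gi Γ) {u : Fin 4 → A}
    (hu : ∀ a b, D a (u b) = D b (u a)) {c : ℝ} {τ : A} (hτ : ∀ a, D a τ = -2 * u a * τ)
    (hE : ∀ a b, ric D (Γ + weylShift g gi u) a b = algebraMap ℝ A c * τ * g a b)
    {L : Fin 4 → Fin 4 → A} (hL : ∀ a b, L a b = algebraMap ℝ A (1 / 2) * (ric D Γ a b
      - algebraMap ℝ A (1 / 6) * (∑ c, ∑ d, gi c d * ric D Γ c d) * g a b)) (m p a : Fin 4) :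
    nabla₂ D Γ L m p a - nabla₂ D Γ L p m a = -∑ d, weylOf D g gi Γ L m p a d * u d := by
  set N := nabla D Γ u
  set s := ∑ e, u e * raise gi u e with hs
  set δ := divergence D Γ (raise gi u)
  set κ := algebraMap ℝ A c * τ with hκ
  have hric : ∀ a b, ric D Γ a b = -2 * N a b - 2 * u a * u b + g a b * (κ - δ + 2 * s) := by
    intro a b
    have h1 := h.ric_add_weylShift hu a b
    rw [hE] at h1
    linear_combination -h1
  have hscal : ∑ a, ∑ b, gi a b * ric D Γ a b = 4 * κ - 6 * δ + 6 * s := by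
    have e1 : ∑ a, ∑ b, gi a b * (u a * u b) = s := by
      rw [hs]
      refine Finset.sum_congr rfl fun a _ => ?_
      rw [raise, Finset.mul_sum]
      exact Finset.sum_congr rfl fun b _ => by ring
    have e2 : ∑ a, ∑ b, gi a b * g a b = 4 := by
      have : ∀ a, ∑ b, gi a b * g a b = 1 := fun a => by
        have e3 := congrFun (congrFun h.inv_mul a) a
        rw [Matrix.mul_apply, Matrix.one_apply_eq] at e3
        rw [← e3]
        exact Finset.sum_congr rfl fun b _ => by
          rw [← congrFun (congrFun h.metric_symm a) b]; rfl
      simp [this]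
    have e4 : ∑ a, ∑ b, gi a b * N a b = δ := h.sum_inv_mul_nabla u
    have e5 : ∀ a b, gi a b * ric D Γ a b = -2 * (gi a b * N a b)
        - 2 * (gi a b * (u a * u b)) + (κ - δ + 2 * s) * (gi a b * g a b) :=
      fun a b => by rw [hric]; ring
    simp only [e5, Finset.sum_add_distrib, Finset.sum_sub_distrib, ← Finset.mul_sum, e1, e2, e4]
    ring
  -- With scalar curvature `4 κ - 6 δ + 6 s`, the divergence drops out of `L` and the coefficient of
  -- `g` is `s / 2 + κ / 6`. The part `K = κ / 6` scales like `τ`, so its derivative is `-2 u K`.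
  refine h.cotton_eq hu (q := algebraMap ℝ A (1 / 2) * s + algebraMap ℝ A (1 / 6) * κ)
    (K := algebraMap ℝ A (1 / 6) * κ) (fun a b => ?_) (fun m => ?_) ?_ m p a
  · rw [hL, hscal, hric]
    linear_combination (-N a b - u a * u b + g a b * κ * algebraMap ℝ A (1 / 6))
      * two_mul_half (A := A) + g a b * algebraMap ℝ A (1 / 2) * (δ - s - κ)
      * six_mul_sixth (A := A)
  · have e1 : D m s = 2 * ∑ e, raise gi u e * N m e := h.deriv_sum_mul_raise u m
    simp only [hκ, map_add, Derivation.leibniz, smul_eq_mul, Derivation.map_algebraMap, mul_zero,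
      add_zero, hτ, e1]
    linear_combination (∑ e, raise gi u e * N m e) * two_mul_half (A := A)
  · linear_combination s * two_mul_half (A := A)

end Cotton

/-! ### Tensoriality of the Ricci tensor under coordinate changes -/

section CoordinateChange

open Matrix

variable {A : Type*} [CommRing A] [Algebra ℝ A] {D : Fin 4 → Derivation ℝ A A}

/-- The pull-back of connection matrices: `J` is the Jacobian matrix, `Γ` the composition of the
connection matrices with the coordinate change. -/
def pullbackMat (J : Matrix (Fin 4) (Fin 4) A) (Γ : Fin 4 → Matrix (Fin 4) (Fin 4) A) (a : Fin 4) :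
    Matrix (Fin 4) (Fin 4) A := ∑ i, J i a • Γ i

/-- The transform of connection matrices under a change of coordinates. -/
def gaugeTransform (D : Fin 4 → Derivation ℝ A A) (J Ji : Matrix (Fin 4) (Fin 4) A)
    (Γ : Fin 4 → Matrix (Fin 4) (Fin 4) A) (a : Fin 4) : Matrix (Fin 4) (Fin 4) A :=
  Ji * pullbackMat J Γ a * J + Ji * matDeriv (D a) J

/-- The inhomogeneous term `Ji * dJ` is a flat connection, and its cross terms with the conjugated
part cancel. Only invertibility of `J` matters here. -/
theorem curv_gaugeTransform (hD : CommutingDerivations D) {J Ji : Matrix (Fin 4) (Fin 4) A}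
    (hJ : Ji * J = 1) (Γ : Fin 4 → Matrix (Fin 4) (Fin 4) A) (a b : Fin 4) :
    curv D (gaugeTransform D J Ji Γ) a b = Ji * curv D (pullbackMat J Γ) a b * J := by
  have hJ' : J * Ji = 1 := mul_eq_one_comm.mp hJ
  have hdJi : ∀ a, matDeriv (D a) Ji = -(Ji * matDeriv (D a) J * Ji) := by
    intro a
    have h1 : matDeriv (D a) Ji * J + Ji * matDeriv (D a) J = 0 := by
      rw [← matDeriv_mul, hJ, matDeriv_one]
    calc matDeriv (D a) Ji = matDeriv (D a) Ji * (J * Ji) := by rw [hJ', mul_one]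
      _ = (matDeriv (D a) Ji * J + Ji * matDeriv (D a) J) * Ji - Ji * matDeriv (D a) J * Ji := by
        noncomm_ring
      _ = _ := by rw [h1]; noncomm_ring
  set P := pullbackMat J Γ
  have hprod : ∀ a b, gaugeTransform D J Ji Γ b * gaugeTransform D J Ji Γ a
      = Ji * P b * P a * J + Ji * P b * matDeriv (D a) J
        + Ji * matDeriv (D b) J * Ji * P a * J
        + Ji * matDeriv (D b) J * Ji * matDeriv (D a) J := by
    intro a b
    calc gaugeTransform D J Ji Γ b * gaugeTransform D J Ji Γ a
      = Ji * P b * (J * Ji) * P a * J + Ji * P b * (J * Ji) * matDeriv (D a) J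
        + Ji * matDeriv (D b) J * Ji * P a * J
        + Ji * matDeriv (D b) J * Ji * matDeriv (D a) J := by
          simp only [gaugeTransform]; noncomm_ring
      _ = _ := by rw [hJ']; simp only [mul_one]
  rw [curv, add_sub_assoc, hprod, hprod]
  simp only [gaugeTransform, curv, matDeriv_add, matDeriv_mul, hdJi]
  rw [hD.matDeriv a b J]
  noncomm_ring

/-- Coordinate data pulled back along a change of coordinates: metric, connection matrices and the
first derivatives of the connection matrices, all composed with the coordinate change. -/
structure IsCoordinateChange (D : Fin 4 → Derivation ℝ A A) (J Ji g : Matrix (Fin 4) (Fin 4) A)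
    (Γ : Fin 4 → Matrix (Fin 4) (Fin 4) A)
    (dΓ : Fin 4 → Fin 4 → Matrix (Fin 4) (Fin 4) A) : Prop where
  comm : CommutingDerivations D
  inv_mul : Ji * J = 1
  closed : ∀ a b k, D a (J k b) = D b (J k a)
  metric_symm : gᵀ = g
  torsion_free : ∀ a c d, Γ a d c = Γ c d a
  deriv_metric : ∀ a, matDeriv (D a) g = ∑ i, J i a • ((Γ i)ᵀ * g + g * Γ i)
  deriv_conn : ∀ a i, matDeriv (D a) (Γ i) = ∑ j, J j a • dΓ j i

namespace IsCoordinateChange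

variable {J Ji g : Matrix (Fin 4) (Fin 4) A} {Γ : Fin 4 → Matrix (Fin 4) (Fin 4) A}
    {dΓ : Fin 4 → Fin 4 → Matrix (Fin 4) (Fin 4) A}

/-- Torsion-freeness survives because the second derivatives of the coordinate change, `D a (J k
c)`, are symmetric; in compatibility, the term `Ji * dJ` accounts for the derivatives of the outer
factors of `Jᵀ * g * J`. -/
theorem isLeviCivita (h : IsCoordinateChange D J Ji g Γ dΓ) {gi : Matrix (Fin 4) (Fin 4) A}
    (hgi : gi * (Jᵀ * g * J) = 1) :
    IsLeviCivita D (Jᵀ * g * J) gi (gaugeTransform D J Ji Γ) := by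
  have hJ' : J * Ji = 1 := mul_eq_one_comm.mp h.inv_mul
  refine ⟨h.comm, ?_, hgi, fun a c d => ?_, fun a => ?_⟩
  · rw [transpose_mul, transpose_mul, transpose_transpose, h.metric_symm, mul_assoc]
  · have h1 : ∀ a, pullbackMat J Γ a * J + matDeriv (D a) J
        = Matrix.of fun k c => (∑ l, ∑ i, J i a * Γ i k l * J l c) + D a (J k c) := by
      intro a
      ext k c
      simp only [pullbackMat, Finset.sum_mul, Matrix.add_apply, Matrix.sum_apply, Matrix.mul_apply,
        Matrix.smul_apply, Matrix.of_apply, smul_mul, smul_eq_mul, matDeriv_apply, Finset.mul_sum]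
      rw [Finset.sum_comm]
      simp only [mul_assoc]
    simp only [gaugeTransform, mul_assoc, ← mul_add]
    rw [h1, h1, Matrix.mul_apply, Matrix.mul_apply]
    refine Finset.sum_congr rfl fun k _ => ?_
    simp only [Matrix.of_apply]
    rw [h.closed a c, Finset.sum_comm]
    congr 2
    exact Finset.sum_congr rfl fun i _ => Finset.sum_congr rfl fun l _ => by
      rw [h.torsion_free i l k]; ring
  · have h1 : matDeriv (D a) g = (pullbackMat J Γ a)ᵀ * g + g * pullbackMat J Γ a := by
      rw [h.deriv_metric]
      simp only [pullbackMat, transpose_sum, transpose_smul, Finset.sum_mul, Finset.mul_sum,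
        smul_add, Finset.sum_add_distrib, Matrix.smul_mul, Matrix.mul_smul]
    set P := pullbackMat J Γ a
    have h2 : Jᵀ * g * J * gaugeTransform D J Ji Γ a
        = Jᵀ * g * P * J + Jᵀ * g * matDeriv (D a) J := by
      calc _ = Jᵀ * g * (J * Ji) * P * J + Jᵀ * g * (J * Ji) * matDeriv (D a) J := by
            simp only [gaugeTransform]; noncomm_ring
        _ = _ := by rw [hJ']; noncomm_ring
    have h3 : (gaugeTransform D J Ji Γ a)ᵀ * (Jᵀ * g * J)
        = Jᵀ * Pᵀ * g * J + (matDeriv (D a) J)ᵀ * g * J := by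
      have h4 := congrArg transpose h2
      simp only [transpose_mul, transpose_add, transpose_transpose, h.metric_symm] at h4
      simp only [mul_assoc] at h4 ⊢
      exact h4
    rw [h2, h3, matDeriv_mul, matDeriv_mul, h1, matDeriv_transpose]
    noncomm_ring

/-- Curvature pulls back as a two-form: the derivatives of `J` cancel by `closed`. -/
theorem curv_pullbackMat (h : IsCoordinateChange D J Ji g Γ dΓ) (a b : Fin 4) :
    curv D (pullbackMat J Γ) a b
      = ∑ i, ∑ j, (J i a * J j b) • (dΓ j i - dΓ i j + Γ j * Γ i - Γ i * Γ j) := by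
  have h1 : ∀ a b, matDeriv (D b) (pullbackMat J Γ a)
      = ∑ i, D b (J i a) • Γ i + ∑ i, ∑ j, (J i a * J j b) • dΓ j i := by
    intro a b
    simp only [pullbackMat, matDeriv_sum, matDeriv_smul, h.deriv_conn, Finset.sum_add_distrib,
      Finset.smul_sum, smul_smul]
  have h2 : ∀ a b, pullbackMat J Γ b * pullbackMat J Γ a
      = ∑ i, ∑ j, (J i a * J j b) • (Γ j * Γ i) := by
    intro a b
    simp only [pullbackMat, Finset.sum_mul, Finset.mul_sum, Matrix.smul_mul, Matrix.mul_smul,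
      smul_smul]
  have h3 : ∑ i, D a (J i b) • Γ i = ∑ i, D b (J i a) • Γ i :=
    Finset.sum_congr rfl fun i _ => by rw [h.closed a b]
  have hsw : ∀ Z : Fin 4 → Fin 4 → Matrix (Fin 4) (Fin 4) A,
      ∑ i, ∑ j, (J i b * J j a) • Z j i = ∑ i, ∑ j, (J i a * J j b) • Z i j := by
    intro Z
    rw [Finset.sum_comm]
    exact Finset.sum_congr rfl fun i _ => Finset.sum_congr rfl fun j _ => by rw [mul_comm]
  rw [curv, h1, h1, h2, h2, h3, hsw fun j i => dΓ j i, hsw fun j i => Γ j * Γ i]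
  simp only [smul_add, smul_sub, Finset.sum_add_distrib, Finset.sum_sub_distrib]
  abel

/-- The Ricci tensor transforms as a tensor. -/
theorem ric_gaugeTransform (h : IsCoordinateChange D J Ji g Γ dΓ) (a c : Fin 4) :
    ric D (gaugeTransform D J Ji Γ) a c = ∑ i, ∑ l, J i a * J l c
      * ∑ j, (dΓ j i - dΓ i j + Γ j * Γ i - Γ i * Γ j) j l := by
  have hJ' : J * Ji = 1 := mul_eq_one_comm.mp h.inv_mul
  set K : Fin 4 → Fin 4 → Matrix (Fin 4) (Fin 4) A :=
    fun i j => dΓ j i - dΓ i j + Γ j * Γ i - Γ i * Γ j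
  have h1 : ∀ b, curv D (gaugeTransform D J Ji Γ) a b
      = ∑ i, ∑ j, (J i a * J j b) • (Ji * K i j * J) := by
    intro b
    rw [curv_gaugeTransform h.comm h.inv_mul, h.curv_pullbackMat]
    simp only [Finset.sum_mul, Finset.mul_sum, Matrix.smul_mul, Matrix.mul_smul]
    rfl
  simp only [ric, h1, Matrix.sum_apply, Matrix.smul_apply, smul_eq_mul]
  rw [Finset.sum_comm]
  refine Finset.sum_congr rfl fun i _ => ?_
  rw [Finset.sum_comm]
  have h3 : ∀ j, ∑ b, J i a * J j b * (Ji * K i j * J) b c = ∑ l, J i a * J l c * K i j j l := by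
    intro j
    have h4 : ∑ b, J j b * (Ji * K i j * J) b c = (J * (Ji * K i j * J)) j c :=
      (Matrix.mul_apply).symm
    simp only [mul_assoc, ← Finset.mul_sum]
    rw [← mul_assoc Ji, h4, ← mul_assoc, ← mul_assoc, hJ', one_mul, Matrix.mul_apply]
    congr 1
    exact Finset.sum_congr rfl fun l _ => mul_comm _ _
  simp only [h3]
  rw [Finset.sum_comm]
  exact Finset.sum_congr rfl fun l _ => (Finset.mul_sum _ _ _).symm

end IsCoordinateChange

/-- The Ricci tensor of a metric transforms as a tensor: `P` is the pull-back of functions along a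
change of coordinates with Jacobian matrix `J`. -/
theorem IsLeviCivita.ric_pullback {B : Type*} [CommRing B] [Algebra ℝ B]
    {D' : Fin 4 → Derivation ℝ B B} {g gi : Matrix (Fin 4) (Fin 4) B}
    {Γ : Fin 4 → Matrix (Fin 4) (Fin 4) B} (h : IsLeviCivita D' g gi Γ)
    {J Ji : Matrix (Fin 4) (Fin 4) A} (hJ : Ji * J = 1)
    (hclosed : ∀ a b k, D a (J k b) = D b (J k a)) (P : B →ₐ[ℝ] A)
    (hP : ∀ a f, D a (P f) = ∑ i, J i a * P (D' i f))
    {g' gi' : Matrix (Fin 4) (Fin 4) A} {Γ' : Fin 4 → Matrix (Fin 4) (Fin 4) A}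
    (h' : IsLeviCivita D g' gi' Γ') (hg' : g' = Jᵀ * g.map P * J) (a c : Fin 4) :
    ric D Γ' a c = ∑ i, ∑ l, J i a * J l c * P (ric D' Γ i l) := by
  have hderiv : ∀ a (X : Matrix (Fin 4) (Fin 4) B),
      matDeriv (D a) (X.map P) = ∑ i, J i a • (matDeriv (D' i) X).map P := fun a X => by
    refine Matrix.ext fun p q => ?_
    simp only [matDeriv_apply, Matrix.map_apply, Matrix.sum_apply, Matrix.smul_apply, smul_eq_mul]
    exact hP a _
  have hcc : IsCoordinateChange D J Ji (g.map P) (fun i => (Γ i).map P)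
      (fun j i => (matDeriv (D' j) (Γ i)).map P) :=
    { comm := h'.comm
      inv_mul := hJ
      closed := hclosed
      metric_symm := by rw [← transpose_map, h.metric_symm]
      torsion_free := fun a c d => congrArg P (h.torsion_free a c d)
      deriv_metric := fun a => by
        rw [hderiv]
        refine Finset.sum_congr rfl fun i _ => ?_
        rw [h.compat, Matrix.map_add _ (map_add P), Matrix.map_mul, Matrix.map_mul, transpose_map]
      deriv_conn := fun a i => hderiv a _ }
  have hinv : gi' * (Jᵀ * g.map P * J) = 1 := by rw [← hg', h'.inv_mul]
  have hlc := hcc.isLeviCivita hinv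
  rw [← hg'] at hlc
  -- Uniqueness of the Levi-Civita connection identifies `Γ'` with the gauge transform of the
  -- pulled-back `Γ`.
  rw [h'.eq_leviCivita, ← hlc.eq_leviCivita, hcc.ric_gaugeTransform]
  refine Finset.sum_congr rfl fun i _ => Finset.sum_congr rfl fun l _ => ?_
  rw [ric, map_sum]
  congr 1
  refine Finset.sum_congr rfl fun j _ => ?_
  rw [← Matrix.map_apply (f := P), curv, Matrix.map_sub _ (map_sub P), Matrix.map_add _ (map_add P),
    Matrix.map_sub _ (map_sub P), Matrix.map_mul, Matrix.map_mul]

end CoordinateChange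

end CConn

namespace CConn

/-! ### The quadratic identity in dimension four -/

section QuadraticIdentity

/-- In dimension four, `C_{da}^{mp} C_{mp}^{ae}` is pure trace for a trace-free double two-form. -/
theorem sum_mul_eq_quarter_of_traceFree (Y : Fin 4 → Fin 4 → Fin 4 → Fin 4 → ℝ)
    (h1 : ∀ a b m p, Y a b m p = -Y b a m p) (h2 : ∀ a b m p, Y a b m p = -Y a b p m)
    (h3 : ∀ b d, ∑ a, Y a b a d = 0) (d e : Fin 4) :
    ∑ a, ∑ m, ∑ p, Y d a m p * Y m p a e
      = -(1 / 4) * (if d = e then 1 else 0) * ∑ a, ∑ b, ∑ m, ∑ p, Y a b m p * Y m p a b := by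
  have d1 : ∀ a m p, Y a a m p = 0 := fun a m p => by linarith [h1 a a m p]
  have d2 : ∀ a b m, Y a b m m = 0 := fun a b m => by linarith [h2 a b m m]
  have a10 := h1 1 0
  have a20 := h1 2 0
  have a30 := h1 3 0
  have a21 := h1 2 1
  have a31 := h1 3 1
  have a32 := h1 3 2
  have b10 := fun a b => h2 a b 1 0
  have b20 := fun a b => h2 a b 2 0
  have b30 := fun a b => h2 a b 3 0
  have b21 := fun a b => h2 a b 2 1
  have b31 := fun a b => h2 a b 3 1
  have b32 := fun a b => h2 a b 3 2
  have t : ∀ b d, Y 0 b 0 d + Y 1 b 1 d + Y 2 b 2 d + Y 3 b 3 d = 0 := fun b d => by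
    rw [← h3 b d, Fin.sum_univ_four]
  have t00 := t 0 0
  have t01 := t 0 1
  have t02 := t 0 2
  have t03 := t 0 3
  have t10 := t 1 0
  have t11 := t 1 1
  have t12 := t 1 2
  have t13 := t 1 3
  have t20 := t 2 0
  have t21 := t 2 1
  have t22 := t 2 2
  have t23 := t 2 3
  have t30 := t 3 0
  have t31 := t 3 1
  have t32 := t 3 2
  have t33 := t 3 3
  simp only [d1, d2, a10, a20, a30, a21, a31, a32, b10, b20, b30, b21, b31, b32, neg_neg, zero_add,
    add_zero] at t00 t01 t02 t03 t10 t11 t12 t13 t20 t21 t22 t23 t30 t31 t32 t33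
  -- The 16 trace equations are solved for 16 of the 36 components left by the antisymmetries. The
  -- other 20 are free; no pair symmetry is used.
  have e2323 : Y 2 3 2 3 = Y 0 1 0 1 := by linarith
  have e1313 : Y 1 3 1 3 = Y 0 2 0 2 := by linarith
  have e1212 : Y 1 2 1 2 = Y 0 3 0 3 := by linarith
  have e0303 : Y 0 3 0 3 = -Y 0 1 0 1 - Y 0 2 0 2 := by linarith
  have e0313 : Y 0 3 1 3 = -Y 0 2 1 2 := by linarith
  have e0323 : Y 0 3 2 3 = Y 0 1 1 2 := by linarith
  have e0223 : Y 0 2 2 3 = -Y 0 1 1 3 := by linarith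
  have e1303 : Y 1 3 0 3 = -Y 1 2 0 2 := by linarith
  have e1323 : Y 1 3 2 3 = -Y 0 1 0 2 := by linarith
  have e1223 : Y 1 2 2 3 = Y 0 1 0 3 := by linarith
  have e2303 : Y 2 3 0 3 = Y 1 2 0 1 := by linarith
  have e2313 : Y 2 3 1 3 = -Y 0 2 0 1 := by linarith
  have e1213 : Y 1 2 1 3 = -Y 0 2 0 3 := by linarith
  have e2302 : Y 2 3 0 2 = -Y 1 3 0 1 := by linarith
  have e2312 : Y 2 3 1 2 = Y 0 3 0 1 := by linarith
  have e1312 : Y 1 3 1 2 = -Y 0 3 0 2 := by linarith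
  clear t00 t01 t02 t03 t10 t11 t12 t13 t20 t21 t22 t23 t30 t31 t32 t33 t
  have hsum : ∀ F : Fin 4 → Fin 4 → ℝ, (∀ m, F m m = 0) → (∀ m p, F m p = F p m) →
      ∑ m, ∑ p, F m p = 2 * (F 0 1 + F 0 2 + F 0 3 + F 1 2 + F 1 3 + F 2 3) := by
    intro F hF hs
    simp only [Fin.sum_univ_four, hF, hs 1 0, hs 2 0, hs 3 0, hs 2 1, hs 3 1, hs 3 2]
    ring
  have hin : ∀ d a e, ∑ m, ∑ p, Y d a m p * Y m p a e = 2 * (Y d a 0 1 * Y 0 1 a e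
      + Y d a 0 2 * Y 0 2 a e + Y d a 0 3 * Y 0 3 a e + Y d a 1 2 * Y 1 2 a e
      + Y d a 1 3 * Y 1 3 a e + Y d a 2 3 * Y 2 3 a e) := fun d a e =>
    hsum _ (fun m => by rw [d1, mul_zero]) fun m p => by rw [h1 p m, h2 d a p m]; ring
  -- The full contraction is minus the trace of the left side, so the claim becomes that a 4×4
  -- matrix equals a quarter of its trace times the identity. This is checked entry by entry as a
  -- polynomial identity.
  have htot : ∑ a, ∑ b, ∑ m, ∑ p, Y a b m p * Y m p a b = -∑ d, ∑ a, ∑ m, ∑ p, Y d a m p * Y m p a d := by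
    simp only [← Finset.sum_neg_distrib]
    exact Finset.sum_congr rfl fun a _ => Finset.sum_congr rfl fun b _ =>
      Finset.sum_congr rfl fun m _ => Finset.sum_congr rfl fun p _ => by rw [h2 m p b a]; ring
  rw [htot]
  simp only [hin]
  clear htot hin hsum h1 h2 h3
  fin_cases d <;> fin_cases e <;>
    (simp only [Fin.zero_eta, Fin.mk_one, Fin.reduceFinMk, Fin.sum_univ_four, d1, d2, a10, a20, a30,
      a21, a31, a32, b10, b20, b30, b21, b31, b32, e2323, e1313, e1212, e0303, e0313, e0323, e0223,
      e1303, e1323, e1223, e2303, e2313, e1213, e2302, e2312, e1312, Fin.isValue, Fin.reduceEq,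
      if_true, if_false]
     ring)

end QuadraticIdentity

end CConn

namespace CConn

/-! ### From coordinate formulas to the algebra of smooth functions -/

section Evaluation

open Matrix

variable {U : TopologicalSpace.Opens E4}

namespace SmoothFn

/-- Evaluation at a point. -/
def ev (y : U) : SmoothFn U →ₐ[ℝ] ℝ := (Pi.evalAlgHom ℝ (fun _ : U => ℝ) y).comp (SmoothFn U).val

theorem ext_ev {f f' : SmoothFn U} (h : ∀ y : U, ev y f = ev y f') : f = f' := ext_apply h

@[simp] theorem ev_mk (F : E4 → ℝ) (hF : ContDiffOn ℝ ∞ F U) (y : U) : ev y (mk F hF) = F y := rfl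

@[simp] theorem ev_algebraMap (r : ℝ) (y : U) : ev y (algebraMap ℝ (SmoothFn U) r) = r := rfl

theorem partialD_eq_ev {f : SmoothFn U} {F : E4 → ℝ} (h : ∀ y : U, F y = ev y f) (i : Fin 4)
    (y : U) : partialD i F y = ev y (D i f) :=
  partialD_eq h i y

/-- Turns pointwise nonvanishing into invertibility in the algebra, as needed for the inverses of
the metric, the Jacobian and the conformal factor. -/
theorem exists_mul_eq_one (f : SmoothFn U) (hf : ∀ y : U, ev y f ≠ 0) : ∃ f', f' * f = 1 := by
  refine ⟨mk (fun y => (zeroExtend f.1 y)⁻¹) ((contDiffOn f).inv fun y hy => ?_), ?_⟩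
  · rw [zeroExtend_apply _ ⟨y, hy⟩]; exact hf ⟨y, hy⟩
  · refine ext_ev fun y => ?_
    rw [map_mul, ev_mk, zeroExtend_apply, map_one]
    exact inv_mul_cancel₀ (hf y)

theorem commutingDerivations : CommutingDerivations (D : Fin 4 → Derivation ℝ (SmoothFn U) _) :=
  fun i j f => D_comm i j f

theorem riemann_eq {Γ : E4 → Fin 4 → Fin 4 → Fin 4 → ℝ}
    {Γ' : Fin 4 → Matrix (Fin 4) (Fin 4) (SmoothFn U)}
    (h : ∀ (y : U) c a b, Γ y c a b = ev y (Γ' a c b)) (y : U) (a b c d : Fin 4) :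
    riemann Γ y a b c d = ev y (curv D Γ' a b d c) := by
  simp only [riemann, curv, Matrix.add_apply, Matrix.sub_apply, matDeriv_apply, Matrix.mul_apply,
    map_add, map_sub, map_sum, map_mul, Finset.sum_sub_distrib]
  rw [partialD_eq_ev (fun z => h z d a c), partialD_eq_ev (fun z => h z d b c)]
  simp only [h, mul_comm]
  ring

theorem ricci_eq {Γ : E4 → Fin 4 → Fin 4 → Fin 4 → ℝ}
    {Γ' : Fin 4 → Matrix (Fin 4) (Fin 4) (SmoothFn U)}
    (h : ∀ (y : U) c a b, Γ y c a b = ev y (Γ' a c b)) (y : U) (a c : Fin 4) :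
    ricci Γ y a c = ev y (ric D Γ' a c) := by
  simp only [ricci, ric, map_sum, riemann_eq h]

end SmoothFn

open SmoothFn

/-- `G` is a smooth field of nondegenerate symmetric matrices on `U`. -/
structure IsMetricOn (U : TopologicalSpace.Opens E4) (G : E4 → Matrix (Fin 4) (Fin 4) ℝ) :
    Prop where
  smooth : ∀ a b, ContDiffOn ℝ ∞ (fun y => G y a b) U
  symm : ∀ y ∈ U, ∀ a b, G y a b = G y b a
  isUnit_det : ∀ y ∈ U, IsUnit (G y).det

namespace IsMetricOn

variable {G : E4 → Matrix (Fin 4) (Fin 4) ℝ} (h : IsMetricOn U G)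

/-- The metric as a matrix of smooth functions. -/
def mat (h : IsMetricOn U G) : Matrix (Fin 4) (Fin 4) (SmoothFn U) :=
  Matrix.of fun a b => SmoothFn.mk (fun y => G y a b) (h.smooth a b)

/-- The inverse metric as a matrix of smooth functions. -/
def inv (h : IsMetricOn U G) : Matrix (Fin 4) (Fin 4) (SmoothFn U) := (h.mat)⁻¹

/-- The Levi-Civita connection matrices. -/
def conn (h : IsMetricOn U G) : Fin 4 → Matrix (Fin 4) (Fin 4) (SmoothFn U) :=
  leviCivita D h.mat h.inv

@[simp] theorem ev_mat (y : U) (a b : Fin 4) : ev y (h.mat a b) = G y a b := rfl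

theorem mat_transpose : (h.mat)ᵀ = h.mat := by
  refine Matrix.ext fun a b => ?_
  exact ext_ev (f := h.mat b a) (f' := h.mat a b) fun y => h.symm y y.2 b a

theorem inv_mul_mat : h.inv * h.mat = 1 := by
  have hdet : ∀ y : U, ev y h.mat.det ≠ 0 := fun y => by
    rw [AlgHom.map_det]
    exact (h.isUnit_det y y.2).ne_zero
  obtain ⟨f, hf⟩ := exists_mul_eq_one _ hdet
  exact Matrix.nonsing_inv_mul _ (IsUnit.of_mul_eq_one_right f hf)

@[simp] theorem ev_inv (y : U) (a b : Fin 4) : ev y (h.inv a b) = ginv G y a b := by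
  have h1 : h.inv.map (ev y) * G y = 1 := by
    have h2 : (h.inv * h.mat).map (ev y) = h.inv.map (ev y) * h.mat.map (ev y) := Matrix.map_mul
    rw [h.inv_mul_mat] at h2
    have h3 : h.mat.map (ev y) = G y := rfl
    rw [h3] at h2
    rw [← h2, Matrix.map_one _ (map_zero _) (map_one _)]
  rw [ginv, Matrix.inv_eq_left_inv h1]; rfl

theorem isLeviCivita : IsLeviCivita D h.mat h.inv h.conn :=
  isLeviCivita_leviCivita commutingDerivations h.mat_transpose h.inv_mul_mat

theorem christoffel_eq (y : U) (c a b : Fin 4) : christoffel G y c a b = ev y (h.conn a c b) := by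
  have hG : ∀ i a b, partialD i (fun z => G z a b) y = ev y (D i (h.mat a b)) := fun i a b =>
    partialD_eq_ev (fun z => (h.ev_mat z a b).symm) i y
  simp only [christoffel, conn, leviCivita, Matrix.of_apply, map_mul, map_sum, map_add, map_sub,
    ev_algebraMap, ev_inv, hG]

theorem metricRicci_eq (y : U) (a b : Fin 4) : metricRicci G y a b = ev y (ric D h.conn a b) :=
  ricci_eq h.christoffel_eq y a b

/-- The Schouten tensor as an array of smooth functions. -/
def schoutenFn (h : IsMetricOn U G) (a b : Fin 4) : SmoothFn U :=
  algebraMap ℝ _ (1 / 2) * (ric D h.conn a b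
    - algebraMap ℝ _ (1 / 6) * (∑ c, ∑ d, h.inv c d * ric D h.conn c d) * h.mat a b)

theorem schouten_eq (y : U) (a b : Fin 4) : schouten G y a b = ev y (h.schoutenFn a b) := by
  simp only [schouten, schoutenFn, scalarCurv, h.metricRicci_eq, map_mul, map_sub, map_sum,
    ev_algebraMap, ev_inv, ev_mat]

theorem weyl_eq (y : U) (a b c d : Fin 4) :
    weyl G y a b c d = ev y (weylOf D h.mat h.inv h.conn h.schoutenFn a b c d) := by
  simp only [weyl, weylOf, schoutenUp, h.schouten_eq, map_mul, map_sub, map_sum, ev_inv, ev_mat,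
    riemann_eq h.christoffel_eq, delta, apply_ite (ev y), map_one, map_zero]

theorem nablaSchouten_eq (y : U) (m p a : Fin 4) :
    nablaSchouten G y m p a = ev y (nabla₂ D h.conn h.schoutenFn m p a) := by
  simp only [nablaSchouten, nabla₂, map_sub, map_sum, map_add, map_mul, h.schouten_eq,
    h.christoffel_eq]
  rw [partialD_eq_ev (fun z => h.schouten_eq z p a)]

end IsMetricOn

end Evaluation

/-! ### Symmetries and traces of the Riemann and Weyl tensors at a point -/

section PointwiseAlgebra

variable {U : TopologicalSpace.Opens E4} {G : E4 → Matrix (Fin 4) (Fin 4) ℝ}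

open SmoothFn

namespace IsMetricOn

variable (h : IsMetricOn U G) (y : U)

include h

theorem sum_ginv_mul (a c : Fin 4) : ∑ b, ginv G y a b * G y b c = if a = c then 1 else 0 := by
  have h1 : ginv G y * G y = 1 := Matrix.nonsing_inv_mul _ (h.isUnit_det y y.2)
  rw [← Matrix.mul_apply, h1, Matrix.one_apply]

theorem sum_mul_ginv (a c : Fin 4) : ∑ b, G y a b * ginv G y b c = if a = c then 1 else 0 := by
  have h1 : G y * ginv G y = 1 := Matrix.mul_nonsing_inv _ (h.isUnit_det y y.2)
  rw [← Matrix.mul_apply, h1, Matrix.one_apply]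

theorem ginv_symm (a b : Fin 4) : ginv G y a b = ginv G y b a := by
  rw [← h.ev_inv, ← h.ev_inv]
  exact congrArg (ev y) (congrFun (congrFun h.isLeviCivita.inv_symm b) a)

theorem metricRicci_symm (a b : Fin 4) : metricRicci G y a b = metricRicci G y b a := by
  rw [h.metricRicci_eq, h.metricRicci_eq, h.isLeviCivita.ric_symm]

theorem schouten_symm (a b : Fin 4) : schouten G y a b = schouten G y b a := by
  simp only [schouten, h.metricRicci_symm y a b, h.symm y y.2 a b]

end IsMetricOn

theorem riemann_antisymm (Γ : E4 → Fin 4 → Fin 4 → Fin 4 → ℝ) (y : E4) (a b c d : Fin 4) :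
    riemann Γ y a b c d = -riemann Γ y b a c d := by
  simp only [riemann, Finset.sum_sub_distrib]; ring

theorem weyl_antisymm (y : E4) (a b c d : Fin 4) : weyl G y a b c d = -weyl G y b a c d := by
  simp only [weyl, riemann_antisymm _ y a b]; ring

namespace IsMetricOn

variable (h : IsMetricOn U G) (y : U)

include h

theorem sum_schoutenUp_mul (a b : Fin 4) :
    ∑ e, schoutenUp G y e a * G y e b = schouten G y b a := by
  have : ∀ k, ∑ e, ginv G y e k * G y e b = if k = b then 1 else 0 := fun k => by
    rw [← h.sum_ginv_mul y k b]
    exact Finset.sum_congr rfl fun e _ => by rw [h.ginv_symm y e k]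
  simp only [schoutenUp, Finset.sum_mul]
  rw [Finset.sum_comm]
  have h2 : ∀ k, ∑ e, ginv G y e k * schouten G y k a * G y e b
      = schouten G y k a * if k = b then 1 else 0 := fun k => by
    rw [← this k, Finset.mul_sum]
    exact Finset.sum_congr rfl fun e _ => by ring
  simp only [h2]
  simp

/-- With all indices down, the symmetries of the Schouten correction can be read off, and those of
`C` reduce to those of the Riemann tensor. -/
theorem weylDown_eq (a b c d : Fin 4) : weylDown G y a b c d
    = ∑ e, riemann (christoffel G) y a b c e * G y e d
      - (schouten G y d b * G y a c - schouten G y d a * G y b c)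
      - (G y b d * schouten G y a c - G y a d * schouten G y b c) := by
  have h1 : ∀ X Y b, ∑ e, delta e b * X * G y e Y = X * G y b Y := fun X Y b => by
    simp [delta, mul_comm]
  have h2 : ∀ X Y b, ∑ e, schoutenUp G y e b * X * G y e Y = X * schouten G y Y b := fun X Y b => by
    rw [← h.sum_schoutenUp_mul y b Y, Finset.mul_sum]
    exact Finset.sum_congr rfl fun e _ => by ring
  simp only [weylDown, weyl, sub_mul, Finset.sum_sub_distrib, h1, h2]
  ring

theorem riemannDown_antisymm (a b c d : Fin 4) :
    ∑ e, riemann (christoffel G) y a b c e * G y e d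
      = -∑ e, riemann (christoffel G) y a b d e * G y e c := by
  have h1 := congrArg (ev y) (congrFun (congrFun (h.isLeviCivita.curv_skew a b) c) d)
  simp only [Matrix.add_apply, Matrix.mul_apply, Matrix.transpose_apply, map_add, map_sum, map_mul,
    ev_mat, ← riemann_eq h.christoffel_eq, Matrix.zero_apply, map_zero] at h1
  have h2 : ∑ e, G y c e * riemann (christoffel G) y a b d e
      = ∑ e, riemann (christoffel G) y a b d e * G y e c :=
    Finset.sum_congr rfl fun e _ => by rw [h.symm y y.2 c e, mul_comm]
  linarith

theorem riemannDown_bianchi (a b c d : Fin 4) :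
    ∑ e, riemann (christoffel G) y a b c e * G y e d
      + ∑ e, riemann (christoffel G) y b c a e * G y e d
      + ∑ e, riemann (christoffel G) y c a b e * G y e d = 0 := by
  rw [← Finset.sum_add_distrib, ← Finset.sum_add_distrib]
  refine Finset.sum_eq_zero fun e _ => ?_
  have h1 := congrArg (ev y) (bianchi_first (D := D) h.isLeviCivita.torsion_free a b c e)
  simp only [map_add, ← riemann_eq h.christoffel_eq, map_zero] at h1
  linear_combination (G y e d) * h1

/-- The classical argument: combine the four cyclic identities obtained by omitting each index in
turn from the cycle, using skewness in each pair. -/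
theorem riemannDown_pair_symm (a b c d : Fin 4) :
    ∑ e, riemann (christoffel G) y a b c e * G y e d
      = ∑ e, riemann (christoffel G) y c d a e * G y e b := by
  let R : Fin 4 → Fin 4 → Fin 4 → Fin 4 → ℝ :=
    fun a b c d => ∑ e, riemann (christoffel G) y a b c e * G y e d
  have r1 : ∀ a b c d, R a b c d = -R b a c d := fun a b c d => by
    simp only [R, riemann_antisymm _ (y : E4) a b, neg_mul, Finset.sum_neg_distrib]
  have r2 : ∀ a b c d, R a b c d = -R a b d c := h.riemannDown_antisymm y
  have r3 : ∀ a b c d, R a b c d + R b c a d + R c a b d = 0 := h.riemannDown_bianchi y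
  change R a b c d = R c d a b
  have := r3 a b c d
  have := r3 b c d a
  have := r3 c d a b
  have := r3 d a b c
  have := r1 a c b d
  have := r2 c a b d
  have := r2 c a d b
  have := r1 a c d b
  have := r1 b d a c
  have := r1 b d c a
  have := r2 d b c a
  have := r2 d b a c
  have := r1 a b c d
  have := r1 a b d c
  have := r2 a b c d
  have := r1 b c a d
  have := r1 b c d a
  have := r2 b c a d
  have := r2 d a b c
  have := r1 c d a b
  have := r2 c d a b
  have := r2 a d b c
  have := r1 d a c b
  have := r1 d a b c
  linarith

theorem weylDown_antisymm (a b c d : Fin 4) : weylDown G y a b c d = -weylDown G y a b d c := by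
  rw [h.weylDown_eq, h.weylDown_eq, h.riemannDown_antisymm y a b c d, h.schouten_symm y d b,
    h.schouten_symm y d a, h.schouten_symm y c b, h.schouten_symm y c a]
  ring

theorem weylDown_pair_symm (a b c d : Fin 4) : weylDown G y a b c d = weylDown G y c d a b := by
  rw [h.weylDown_eq, h.weylDown_eq, h.riemannDown_pair_symm y a b c d, h.schouten_symm y d b,
    h.schouten_symm y d a, h.schouten_symm y c a, h.schouten_symm y b c, h.symm y y.2 c a,
    h.symm y y.2 d a, h.symm y y.2 d b, h.symm y y.2 c b]
  ring

theorem sum_ginv_mul_schouten :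
    ∑ a, ∑ b, ginv G y a b * schouten G y a b = scalarCurv G y / 6 := by
  have h1 : ∑ a, ∑ b, ginv G y a b * G y a b = 4 := by
    have : ∀ a, ∑ b, ginv G y a b * G y a b = 1 := fun a => by
      have := h.sum_ginv_mul y a a
      rw [if_pos rfl] at this
      rw [← this]
      exact Finset.sum_congr rfl fun b _ => by rw [h.symm y y.2 a b]
    simp [this]
  have h2 : ∑ a, ∑ b, ginv G y a b * schouten G y a b
      = 1 / 2 * scalarCurv G y - 1 / 12 * scalarCurv G y * ∑ a, ∑ b, ginv G y a b * G y a b := by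
    have h3 : ∀ a b, ginv G y a b * schouten G y a b
        = 1 / 2 * (ginv G y a b * metricRicci G y a b)
          - 1 / 12 * scalarCurv G y * (ginv G y a b * G y a b) := fun a b => by
      simp only [schouten]; ring
    simp only [h3, Finset.sum_sub_distrib, ← Finset.mul_sum]
    rfl
  rw [h2, h1]; ring

/-- The correction terms have trace `R g_{ac} / 6 + 2 L_{ac}`, which is the Ricci tensor by the
choice of `L`. -/
theorem sum_weyl_trace (a c : Fin 4) : ∑ b, weyl G y a b c b = 0 := by
  have h1 : ∑ b, schoutenUp G y b b = scalarCurv G y / 6 := h.sum_ginv_mul_schouten y ▸ by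
    simp only [schoutenUp]
    exact Finset.sum_congr rfl fun a _ => Finset.sum_congr rfl fun b _ => by
      rw [h.schouten_symm y a b]
  have h2 : ∑ b, schoutenUp G y b a * G y b c = schouten G y c a := h.sum_schoutenUp_mul y a c
  simp only [weyl, Finset.sum_sub_distrib, ← Finset.sum_mul, h1, h2]
  have h3 : ∑ b, riemann (christoffel G) y a b c b = metricRicci G y a c := rfl
  rw [h3, h.schouten_symm y c a]
  simp [delta, schouten]
  ring

end IsMetricOn

end PointwiseAlgebra

end CConn

namespace CConn

/-! ### The Weyl contraction that determines `Λ` -/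

section WeylIdentity

variable {U : TopologicalSpace.Opens E4} {G : E4 → Matrix (Fin 4) (Fin 4) ℝ}

/-- The Weyl tensor `C_{ab}^{mp}`. -/
def weylMixed (G : E4 → Matrix (Fin 4) (Fin 4) ℝ) (y : E4) (a b m p : Fin 4) : ℝ :=
  ∑ f, weyl G y a b f p * ginv G y f m

namespace IsMetricOn

variable (h : IsMetricOn U G) (y : U)

include h

theorem sum_weylDown_mul_ginv (a b c d : Fin 4) :
    ∑ k, weylDown G y a b c k * ginv G y k d = weyl G y a b c d := by
  simp only [weylDown, Finset.sum_mul]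
  rw [Finset.sum_comm]
  simp only [mul_assoc, ← Finset.mul_sum, h.sum_mul_ginv]
  simp

theorem weylMixed_eq (a b m p : Fin 4) : weylMixed G y a b m p
    = ∑ f, ∑ k, weylDown G y a b f k * ginv G y f m * ginv G y k p := by
  simp only [weylMixed, ← h.sum_weylDown_mul_ginv y a b _ p, Finset.sum_mul]
  exact Finset.sum_congr rfl fun f _ => Finset.sum_congr rfl fun k _ => by ring

theorem weylMixed_antisymm_right (a b m p : Fin 4) :
    weylMixed G y a b m p = -weylMixed G y a b p m := by
  rw [h.weylMixed_eq, h.weylMixed_eq, Finset.sum_comm, ← Finset.sum_neg_distrib]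
  refine Finset.sum_congr rfl fun f _ => ?_
  rw [← Finset.sum_neg_distrib]
  exact Finset.sum_congr rfl fun k _ => by rw [h.weylDown_antisymm y a b k f]; ring

omit h in
theorem _root_.CConn.weylMixed_antisymm_left (G : E4 → Matrix (Fin 4) (Fin 4) ℝ) (y : E4)
    (a b m p : Fin 4) : weylMixed G y a b m p = -weylMixed G y b a m p := by
  simp only [weylMixed, weyl_antisymm y a b, neg_mul, Finset.sum_neg_distrib]

/-- Flipping both pairs moves the contraction to the positions covered by `sum_weyl_trace`. -/
theorem sum_weylMixed_trace (b d : Fin 4) : ∑ a, weylMixed G y a b a d = 0 := by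
  have h1 : ∀ a, weylMixed G y a b a d = weylMixed G y b a d a := fun a => by
    rw [weylMixed_antisymm_left, h.weylMixed_antisymm_right, neg_neg]
  rw [Finset.sum_congr rfl fun a _ => h1 a]
  simp only [weylMixed]
  rw [Finset.sum_comm]
  simp only [← Finset.sum_mul, h.sum_weyl_trace, zero_mul, Finset.sum_const_zero]

theorem weylUp_eq (a b c d : Fin 4) :
    weylUp G y a b c d = ∑ e, ginv G y b e * weylMixed G y a e c d := by
  simp only [weylUp, h.weylMixed_eq, Finset.mul_sum]
  exact Finset.sum_congr rfl fun e _ => Finset.sum_congr rfl fun f _ =>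
    Finset.sum_congr rfl fun k _ => by rw [h.ginv_symm y b e]; ring

/-- Pair symmetry of `C` turns the square into the contraction occurring in the quadratic identity,
which involves only the mixed tensor and no metric. -/
theorem weylSq_eq : weylSq G y
    = ∑ a, ∑ b, ∑ m, ∑ p, weylMixed G y a b m p * weylMixed G y m p a b := by
  have h1 : ∀ a b c d, ∑ e, ginv G y a e * weylUp G y e b c d
      = ∑ e, ∑ f, ginv G y a e * ginv G y b f * weylMixed G y e f c d := by
    intro a b c d
    simp only [h.weylUp_eq, Finset.mul_sum, mul_assoc]
  simp only [weylSq, h1, Finset.mul_sum]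
  have h2 : ∀ c d e f, ∑ a, ∑ b, weylDown G y a b c d
        * (ginv G y a e * ginv G y b f * weylMixed G y e f c d)
      = weylMixed G y c d e f * weylMixed G y e f c d := by
    intro c d e f
    rw [h.weylMixed_eq y c d e f]
    simp only [Finset.sum_mul]
    exact Finset.sum_congr rfl fun a _ => Finset.sum_congr rfl fun b _ => by
      rw [h.weylDown_pair_symm y a b c d]; ring
  calc _ = ∑ c, ∑ d, ∑ e, ∑ f, ∑ a, ∑ b, weylDown G y a b c d
        * (ginv G y a e * ginv G y b f * weylMixed G y e f c d) := by
        have h3 : ∀ F : Fin 4 → Fin 4 → Fin 4 → ℝ,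
            ∑ a, ∑ b, ∑ c, F a b c = ∑ c, ∑ a, ∑ b, F a b c := fun F => by
          rw [Finset.sum_comm (s := Finset.univ (α := Fin 4)) (t := Finset.univ)
            (f := fun c a => ∑ b, F a b c)]
          exact Finset.sum_congr rfl fun a _ => Finset.sum_comm
        rw [h3]
        refine Finset.sum_congr rfl fun c _ => ?_
        rw [h3]
        refine Finset.sum_congr rfl fun d _ => ?_
        rw [h3]
        refine Finset.sum_congr rfl fun e _ => ?_
        rw [h3]
    _ = _ := by simp only [h2]

/-- `C_d^{amp} C_{mpa}^e = -(1/4) δ_d^e C·C`. -/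
theorem sum_weylUp_mul_weyl (d e : Fin 4) : ∑ a, ∑ m, ∑ p, weylUp G y d a m p * weyl G y m p a e
    = -(1 / 4) * (if d = e then 1 else 0) * weylSq G y := by
  rw [h.weylSq_eq, ← sum_mul_eq_quarter_of_traceFree (weylMixed G y) (weylMixed_antisymm_left G y)
    (h.weylMixed_antisymm_right y) (h.sum_weylMixed_trace y)]
  have h1 : ∀ m p, ∑ a, weylUp G y d a m p * weyl G y m p a e
      = ∑ k, weylMixed G y d k m p * weylMixed G y m p k e := by
    intro m p
    simp only [h.weylUp_eq, weylMixed.eq_def G y m p, Finset.sum_mul, Finset.mul_sum]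
    rw [Finset.sum_comm]
    exact Finset.sum_congr rfl fun k _ => Finset.sum_congr rfl fun a _ => by ring
  have h2 : ∀ F : Fin 4 → Fin 4 → Fin 4 → ℝ,
      ∑ a, ∑ m, ∑ p, F a m p = ∑ m, ∑ p, ∑ a, F a m p := fun F => by
    rw [Finset.sum_comm]
    exact Finset.sum_congr rfl fun m _ => Finset.sum_comm
  refine (h2 _).trans (Eq.trans ?_ (h2 _).symm)
  simp only [h1]

/-- If the Cotton tensor is the contraction of the Weyl tensor with a covector, then this covector
is `Λ`. -/
theorem lam_eq_of_cotton_eq (hW : weylSq G y ≠ 0) {u : Fin 4 → ℝ}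
    (hu : ∀ m p a, nablaSchouten G y m p a - nablaSchouten G y p m a
      = -∑ e, weyl G y m p a e * u e) (d : Fin 4) : lam G y d = u d := by
  -- The factor `1 / 8` is `(-1/2) * (-1/4)`, from the antisymmetrization and the quadratic
  -- identity; it explains the `8` in `Λ`.
  have h1 : ∑ a, ∑ m, ∑ p, weylUp G y d a m p *
      ((1 / 2) * (nablaSchouten G y m p a - nablaSchouten G y p m a))
      = (1 / 8) * u d * weylSq G y := by
    have h2 : ∑ a, ∑ m, ∑ p, weylUp G y d a m p *
        ((1 / 2) * (nablaSchouten G y m p a - nablaSchouten G y p m a))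
        = ∑ e, (-(1 / 2) * u e) * ∑ a, ∑ m, ∑ p, weylUp G y d a m p * weyl G y m p a e := by
      simp only [hu, Finset.mul_sum, ← Finset.sum_neg_distrib]
      symm
      rw [Finset.sum_comm]
      refine Finset.sum_congr rfl fun a _ => ?_
      rw [Finset.sum_comm]
      refine Finset.sum_congr rfl fun m _ => ?_
      rw [Finset.sum_comm]
      refine Finset.sum_congr rfl fun p _ => ?_
      exact Finset.sum_congr rfl fun e _ => by ring
    rw [h2]
    simp only [h.sum_weylUp_mul_weyl]
    simp
    ring
  rw [lam, h1]
  field_simp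

end IsMetricOn

end WeylIdentity

end CConn

namespace CConn

/-! ### The metric `θ⁻² G` and necessity of the conditions in a chart -/

section ConformalMetric

open SmoothFn Matrix

variable {U : TopologicalSpace.Opens E4} {G : E4 → Matrix (Fin 4) (Fin 4) ℝ}

/-- The metric `θ⁻² G`. -/
def conformalMetric (θ : E4 → ℝ) (G : E4 → Matrix (Fin 4) (Fin 4) ℝ) (y : E4) :
    Matrix (Fin 4) (Fin 4) ℝ := ((θ y) ^ 2)⁻¹ • G y

theorem IsMetricOn.conformalMetric (h : IsMetricOn U G) {θ : E4 → ℝ} (hθ : ContDiffOn ℝ ∞ θ U)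
    (hpos : ∀ y ∈ U, 0 < θ y) : IsMetricOn U (conformalMetric θ G) where
  smooth a b := ((hθ.pow 2).inv fun y hy => (pow_pos (hpos y hy) 2).ne').mul (h.smooth a b)
  symm y hy a b := by
    simp only [CConn.conformalMetric, Matrix.smul_apply, h.symm y hy a b]
  isUnit_det y hy := by
    have h1 := (h.isUnit_det y hy).ne_zero
    have h2 := (hpos y hy).ne'
    rw [isUnit_iff_ne_zero, CConn.conformalMetric, Matrix.det_smul]
    positivity

/-- The logarithmic derivative of `θ`, where `θi` is the inverse of `θ`. -/
def logDeriv (θ θi : SmoothFn U) (a : Fin 4) : SmoothFn U := θi * D a θ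

theorem deriv_of_mul_eq_one {θ θi : SmoothFn U} (hθ : θi * θ = 1) (a : Fin 4) :
    D a θi = -(θi * θi * D a θ) := by
  have h1 : D a (θi * θ) = 0 := by rw [hθ]; exact (D a).map_one_eq_zero
  rw [Derivation.leibniz, smul_eq_mul, smul_eq_mul] at h1
  linear_combination θi * h1 - D a θi * hθ

theorem logDeriv_closed {θ θi : SmoothFn U} (hθ : θi * θ = 1) (a b : Fin 4) :
    D a (logDeriv θ θi b) = D b (logDeriv θ θi a) := by
  simp only [logDeriv, Derivation.leibniz, smul_eq_mul, deriv_of_mul_eq_one hθ, D_comm a b θ]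
  ring

theorem deriv_inv_sq {θ θi : SmoothFn U} (hθ : θi * θ = 1) (a : Fin 4) :
    D a (θi ^ 2) = -2 * logDeriv θ θi a * θi ^ 2 := by
  rw [pow_two, Derivation.leibniz, smul_eq_mul, deriv_of_mul_eq_one hθ, logDeriv]
  ring

/-- Conformal change with factor `τ = θ⁻²`, whose logarithmic derivative is `-2 d log θ`, together
with uniqueness of the Levi-Civita connection. -/
theorem IsMetricOn.conn_conformalMetric (h : IsMetricOn U G) {θ : E4 → ℝ} {θ' θi : SmoothFn U}
    (hθ' : ∀ y : U, θ y = ev y θ') (hθi : θi * θ' = 1)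
    (h' : IsMetricOn U (CConn.conformalMetric θ G)) :
    h'.conn = h.conn + weylShift h.mat h.inv (logDeriv θ' θi) := by
  have hev : ∀ y : U, ev y θi * θ y = 1 := fun y => by rw [hθ', ← map_mul, hθi, map_one]
  have h1 : h'.mat = θi ^ 2 • h.mat := by
    refine Matrix.ext fun a b => ext_ev fun y => ?_
    have h0 : θ y ≠ 0 := right_ne_zero_of_mul_eq_one (hev y)
    rw [Matrix.smul_apply, smul_eq_mul, map_mul, map_pow, ev_mat, ev_mat, eq_inv_of_mul_eq_one_left (hev y)]
    simp [CConn.conformalMetric]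
  have h2 : h'.inv = θ' ^ 2 • h.inv := by
    have h3 : (θ' ^ 2 • h.inv) * h'.mat = 1 := by
      rw [h1, smul_mul_smul_comm, h.inv_mul_mat, ← mul_pow, mul_comm θ', hθi, one_pow, one_smul]
    rw [IsMetricOn.inv, Matrix.inv_eq_left_inv h3]
  have h3 := h.isLeviCivita.conformal (u := logDeriv θ' θi) (τ := θi ^ 2) (τi := θ' ^ 2)
    (by rw [← mul_pow, mul_comm θ', hθi, one_pow]) (deriv_inv_sq hθi)
  rw [h3.eq_leviCivita, ← h1, ← h2]
  rfl

theorem IsMetricOn.cCoeff_eq (h : IsMetricOn U G) {u : Fin 4 → SmoothFn U}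
    (hu : ∀ (y : U) d, lam G y d = ev y (u d)) (y : U) (c a b : Fin 4) :
    cCoeff G y c a b = ev y ((h.conn + weylShift h.mat h.inv u) a c b) := by
  simp only [cCoeff, h.christoffel_eq, hu, Pi.add_apply, Matrix.add_apply, weylShift, raise,
    Matrix.of_apply, map_add, map_sub, map_mul, map_sum, ev_mat, ev_inv, apply_ite (ev y), map_zero,
    delta, Finset.mul_sum]
  congr 1
  have : ∀ d, ginv G y c d * G y a b * ev y (u d) = G y a b * (ginv G y c d * ev y (u d)) :=
    fun d => by ring
  simp only [this]
  split_ifs <;> ring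

theorem IsMetricOn.cRicci_eq (h : IsMetricOn U G) {u : Fin 4 → SmoothFn U}
    (hu : ∀ (y : U) d, lam G y d = ev y (u d)) (y : U) (a b : Fin 4) :
    cRicci G y a b = ev y (ric D (h.conn + weylShift h.mat h.inv u) a b) :=
  ricci_eq (h.cCoeff_eq hu) y a b

/-- The covector `Λ` of a metric conformal to an Einstein metric is the logarithmic derivative of
the conformal factor. -/
theorem IsMetricOn.lam_eq_logDeriv (h : IsMetricOn U G) {θ : E4 → ℝ} {θ' θi : SmoothFn U}
    (hθ' : ∀ y : U, θ y = ev y θ') (hθi : θi * θ' = 1)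
    (h' : IsMetricOn U (CConn.conformalMetric θ G)) {c : ℝ}
    (hE : ∀ y ∈ U, ∀ a b, metricRicci (CConn.conformalMetric θ G) y a b
      = c * CConn.conformalMetric θ G y a b)
    (hW : ∀ y ∈ U, weylSq G y ≠ 0) (y : U) (d : Fin 4) :
    lam G y d = ev y (logDeriv θ' θi d) := by
  have hev : ∀ y : U, ev y θi * θ y = 1 := fun y => by rw [hθ', ← map_mul, hθi, map_one]
  have hric : ∀ a b, ric D (h.conn + weylShift h.mat h.inv (logDeriv θ' θi)) a b
      = algebraMap ℝ _ c * θi ^ 2 * h.mat a b := fun a b => by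
    rw [← h.conn_conformalMetric hθ' hθi h']
    refine ext_ev fun z => ?_
    rw [← h'.metricRicci_eq, hE z z.2, map_mul, map_mul, map_pow, ev_algebraMap,
      eq_inv_of_mul_eq_one_left (hev z), ev_mat]
    simp [CConn.conformalMetric, mul_assoc]
  refine h.lam_eq_of_cotton_eq y (hW y y.2) (u := fun d => ev y (logDeriv θ' θi d))
    (fun m p a => ?_) d
  have h1 := congrArg (ev y) (h.isLeviCivita.cotton_eq_of_ric_eq (logDeriv_closed hθi)
    (deriv_inv_sq hθi) hric (L := h.schoutenFn) (fun _ _ => rfl) m p a)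
  simp only [map_sub, map_neg, map_sum, map_mul, ← h.nablaSchouten_eq, ← h.weyl_eq] at h1
  exact h1

/-- If `θ⁻² G` is an Einstein metric, its Ricci tensor is that of the `𝒞`-connection. -/
theorem IsMetricOn.cRicci_eq_of_einstein (h : IsMetricOn U G) {θ : E4 → ℝ}
    (hθ : ContDiffOn ℝ ∞ θ U) (hpos : ∀ y ∈ U, 0 < θ y) {c : ℝ}
    (hE : ∀ y ∈ U, ∀ a b, metricRicci (CConn.conformalMetric θ G) y a b
      = c * CConn.conformalMetric θ G y a b)
    (hW : ∀ y ∈ U, weylSq G y ≠ 0) (y : U) (a b : Fin 4) :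
    cRicci G y a b = c * CConn.conformalMetric θ G y a b := by
  have h' := h.conformalMetric hθ hpos
  obtain ⟨θi, hθi⟩ := exists_mul_eq_one (SmoothFn.mk θ hθ) fun y => (hpos y y.2).ne'
  have hθ' : ∀ y : U, θ y = ev y (SmoothFn.mk θ hθ) := fun _ => rfl
  rw [h.cRicci_eq (h.lam_eq_logDeriv hθ' hθi h' hE hW), ← h.conn_conformalMetric hθ' hθi h',
    ← h'.metricRicci_eq, hE y y.2]

end ConformalMetric

end CConn

namespace CConn

/-! ### Sufficiency on a convex coordinate domain: Poincaré and Schur lemmas -/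

section Integration

open SmoothFn Matrix

variable {U : TopologicalSpace.Opens E4} {G : E4 → Matrix (Fin 4) (Fin 4) ℝ}

namespace IsMetricOn

theorem contDiffOn_lam (h : IsMetricOn U G) (hW : ∀ y ∈ U, weylSq G y ≠ 0) (d : Fin 4) :
    ContDiffOn ℝ ∞ (fun y => lam G y d) U := by
  have hG := h.smooth
  have hgi : ∀ a b, ContDiffOn ℝ ∞ (fun y => ginv G y a b) U := fun a b =>
    contDiffOn_of_eq (h.inv a b) fun y => (h.ev_inv y a b).symm
  have hweyl : ∀ a b c d, ContDiffOn ℝ ∞ (fun y => weyl G y a b c d) U := fun a b c d =>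
    contDiffOn_of_eq (weylOf D h.mat h.inv h.conn h.schoutenFn a b c d) fun y =>
      h.weyl_eq y a b c d
  have hnab : ∀ a b c, ContDiffOn ℝ ∞ (fun y => nablaSchouten G y a b c) U := fun a b c =>
    contDiffOn_of_eq (nabla₂ D h.conn h.schoutenFn a b c) fun y => h.nablaSchouten_eq y a b c
  have hdown : ∀ a b c d, ContDiffOn ℝ ∞ (fun y => weylDown G y a b c d) U := fun a b c d =>
    ContDiffOn.sum fun e _ => (hweyl a b c e).mul (hG e d)
  have hup : ∀ a b c d, ContDiffOn ℝ ∞ (fun y => weylUp G y a b c d) U := fun a b c d =>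
    ContDiffOn.sum fun e _ => ContDiffOn.sum fun f _ => ContDiffOn.sum fun k _ =>
      (((hdown a e f k).mul (hgi e b)).mul (hgi f c)).mul (hgi k d)
  have hsq : ContDiffOn ℝ ∞ (fun y => weylSq G y) U :=
    ContDiffOn.sum fun a _ => ContDiffOn.sum fun b _ => ContDiffOn.sum fun c _ =>
      ContDiffOn.sum fun d _ => (hdown a b c d).mul
        (ContDiffOn.sum fun e _ => (hgi a e).mul (hup e b c d))
  refine ContDiffOn.div (contDiffOn_const.mul ?_) hsq hW
  exact ContDiffOn.sum fun a _ => ContDiffOn.sum fun m _ => ContDiffOn.sum fun p _ =>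
    (hup d a m p).mul (contDiffOn_const.mul ((hnab m p a).sub (hnab p m a)))

end IsMetricOn

theorem IsMetricOn.closed_of_cRicci_symm (h : IsMetricOn U G) {u : Fin 4 → SmoothFn U}
    (hu : ∀ (y : U) d, lam G y d = ev y (u d))
    (hs : ∀ y ∈ U, ∀ a b, cRicci G y a b = cRicci G y b a) (a b : Fin 4) :
    D a (u b) = D b (u a) :=
  h.isLeviCivita.closed_of_ric_symm (fun a b => ext_ev fun y => by
    rw [← h.cRicci_eq hu, ← h.cRicci_eq hu, hs y y.2]) a b

/-- The Poincaré lemma for one-forms: closedness is symmetry of the derivative of the form `α`, and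
the domain is convex. The potential is smooth because its derivative is. -/
theorem exists_potential (hU : Convex ℝ (U : Set E4)) {lm : E4 → Fin 4 → ℝ}
    (hlm : ∀ d, ContDiffOn ℝ ∞ (fun y => lm y d) U)
    (hc : ∀ y ∈ U, ∀ i j, partialD i (fun z => lm z j) y = partialD j (fun z => lm z i) y) :
    ∃ f : E4 → ℝ, ContDiffOn ℝ ∞ f U ∧ ∀ y ∈ U, ∀ i, partialD i f y = lm y i := by
  let P : Fin 4 → E4 →L[ℝ] ℝ := fun d => EuclideanSpace.proj d
  let α : E4 → E4 →L[ℝ] ℝ := fun y => ∑ d, lm y d • P d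
  have hαs : ContDiffOn ℝ ∞ α U := ContDiffOn.sum fun d _ => (hlm d).smul contDiffOn_const
  have hdiff : ∀ y ∈ U, ∀ d, DifferentiableAt ℝ (fun z => lm z d) y := fun y hy d =>
    ((hlm d).contDiffAt (U.isOpen.mem_nhds hy)).differentiableAt (by simp)
  have hαd : ∀ y ∈ U, ∀ v w, fderiv ℝ α y v w
      = ∑ d, ∑ i, v i * w d * partialD i (fun z => lm z d) y := by
    intro y hy v w
    have h1 : HasFDerivAt α (∑ d, (fderiv ℝ (fun z => lm z d) y).smulRight (P d)) y :=
      HasFDerivAt.fun_sum fun d _ => (hdiff y hy d).hasFDerivAt.smul_const (P d)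
    rw [h1.fderiv]
    simp only [_root_.sum_apply, ContinuousLinearMap.smulRight_apply, _root_.smul_apply,
      smul_eq_mul]
    refine Finset.sum_congr rfl fun d _ => ?_
    conv_lhs => rw [sum_basisVec v, map_sum, Finset.sum_mul]
    refine Finset.sum_congr rfl fun i _ => ?_
    rw [map_smul, smul_eq_mul]
    simp only [partialD]
    change v i * _ * w d = _
    ring
  obtain ⟨f, hf⟩ := hU.exists_forall_hasFDerivAt_of_fderiv_symmetric U.isOpen
    (hαs.differentiableOn (by simp)) (fun y hy v w => by
      rw [hαd y hy, hαd y hy, Finset.sum_comm]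
      exact Finset.sum_congr rfl fun i _ => Finset.sum_congr rfl fun d _ => by
        rw [hc y hy i d]; ring)
  refine ⟨f, ?_, fun y hy i => ?_⟩
  · rw [contDiffOn_infty_iff_fderiv_of_isOpen U.isOpen]
    exact ⟨fun y hy => (hf y hy).differentiableAt.differentiableWithinAt,
      hαs.congr fun y hy => (hf y hy).fderiv⟩
  · rw [partialD, (hf y hy).fderiv]
    simp [α, P, basisVec]

theorem eqOn_const_of_deriv_eq_zero (hU : Convex ℝ (U : Set E4)) {f : SmoothFn U}
    (hf : ∀ i, D i f = 0) : ∃ c : ℝ, ∀ y : U, ev y f = c := by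
  have hdiff : ∀ y ∈ U, DifferentiableAt ℝ (zeroExtend f.1) y := fun y hy =>
    SmoothFn.differentiableAt f ⟨y, hy⟩
  obtain ⟨c, hc⟩ := U.isOpen.exists_is_const_of_fderiv_eq_zero hU.isPreconnected
    (f := zeroExtend f.1) (fun y hy => (hdiff y hy).differentiableWithinAt) (fun y hy => by
      ext v
      rw [sum_basisVec v, map_sum]
      refine Finset.sum_eq_zero fun i _ => ?_
      have : fderiv ℝ (zeroExtend f.1) y (basisVec i) = 0 :=
        (D_apply i f ⟨y, hy⟩).symm.trans (by rw [hf i]; rfl)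
      rw [map_smul, this, smul_zero])
  exact ⟨c, fun y => (zeroExtend_apply f.1 y).symm.trans (hc y y.2)⟩

/-- If the skew and the trace-free parts of the Ricci tensor of the `𝒞`-connection vanish on a
convex open set, the metric is conformal to an Einstein metric there. -/
theorem IsMetricOn.exists_einstein (h : IsMetricOn U G) (hU : Convex ℝ (U : Set E4))
    (hW : ∀ y ∈ U, weylSq G y ≠ 0) (hs : ∀ y ∈ U, ∀ a b, cRicci G y a b = cRicci G y b a)
    (ht : ∀ y ∈ U, ∀ a b, cRicci G y a b = 1 / 4 * G y a b * cScalar G y) :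
    ∃ θ : E4 → ℝ, ContDiffOn ℝ ∞ θ U ∧ (∀ y ∈ U, 0 < θ y) ∧ ∃ c : ℝ, ∀ y ∈ U, ∀ a b,
      metricRicci (CConn.conformalMetric θ G) y a b = c * CConn.conformalMetric θ G y a b := by
  let u : Fin 4 → SmoothFn U := fun d => SmoothFn.mk (fun y => lam G y d) (h.contDiffOn_lam hW d)
  have hu : ∀ (y : U) d, lam G y d = ev y (u d) := fun _ _ => rfl
  obtain ⟨f, hfs, hf⟩ := exists_potential hU (h.contDiffOn_lam hW) (fun y hy i j => by
    rw [partialD_eq_ev (U := U) (fun z => hu z j) i ⟨y, hy⟩,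
      partialD_eq_ev (U := U) (fun z => hu z i) j ⟨y, hy⟩, h.closed_of_cRicci_symm hu hs i j])
  -- The exponential makes the conformal factor positive with `d log θ = df = Λ`.
  have hθ : ContDiffOn ℝ ∞ (fun y => Real.exp (f y)) U := hfs.exp
  have hpos : ∀ y ∈ U, 0 < Real.exp (f y) := fun y _ => Real.exp_pos _
  have h' := h.conformalMetric hθ hpos
  obtain ⟨θi, hθi⟩ := exists_mul_eq_one (SmoothFn.mk _ hθ) fun y => (hpos y y.2).ne'
  have hθ' : ∀ y : U, Real.exp (f y) = ev y (SmoothFn.mk _ hθ) := fun _ => rfl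
  have hul : u = logDeriv (SmoothFn.mk _ hθ) θi := by
    funext d
    refine ext_ev fun y => ?_
    have h1 : ev y (D d (SmoothFn.mk _ hθ)) = Real.exp (f y) * lam G y d := by
      rw [← partialD_eq_ev (F := fun y => Real.exp (f y)) hθ', partialD, fderiv_exp, _root_.smul_apply, smul_eq_mul, ← hf y y.2]
      · rfl
      · exact (hfs.contDiffAt (U.isOpen.mem_nhds y.2)).differentiableAt (by simp)
    have h2 : ev y θi * Real.exp (f y) = 1 := by rw [hθ', ← map_mul, hθi, map_one]
    rw [logDeriv, map_mul, h1, ← hu, ← mul_assoc, h2, one_mul]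
  have hconn := h.conn_conformalMetric hθ' hθi h'
  rw [← hul] at hconn
  have hric : ∀ (y : U) a b, metricRicci (CConn.conformalMetric (fun y => Real.exp (f y)) G) y a b
      = cRicci G y a b := fun y a b => by
    rw [h'.metricRicci_eq, hconn, ← h.cRicci_eq hu]
  refine ⟨_, hθ, hpos, ?_⟩
  -- A quarter of the scalar curvature of `θ⁻² G`: its inverse metric is `θ²` times that of `G`.
  let ρ : SmoothFn U := algebraMap ℝ _ (1 / 4) * (SmoothFn.mk _ hθ) ^ 2
    * ∑ a, ∑ b, h.inv a b * ric D h'.conn a b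
  have hρ : ∀ a b, ric D h'.conn a b = ρ * h'.mat a b := fun a b => ext_ev fun y => by
    rw [← h'.metricRicci_eq, hric, ht y y.2]
    simp only [ρ, map_mul, map_pow, map_sum, ev_algebraMap, ev_mk, ← h'.metricRicci_eq, hric,
      IsMetricOn.ev_inv, IsMetricOn.ev_mat, CConn.conformalMetric, Matrix.smul_apply, smul_eq_mul,
      cScalar]
    field_simp
  obtain ⟨c, hc⟩ := eqOn_const_of_deriv_eq_zero hU
    (fun e => h'.isLeviCivita.deriv_eq_zero_of_ric_eq hρ e)
  refine ⟨c, fun y hy a b => ?_⟩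
  rw [h'.metricRicci_eq ⟨y, hy⟩, hρ, map_mul, hc, IsMetricOn.ev_mat]

end Integration

/-! ### Pull-back of smooth functions and the Ricci tensor in another chart -/

section Transition

open SmoothFn Matrix

variable {U V : TopologicalSpace.Opens E4}

/-- Pull-back of smooth functions. -/
def SmoothFn.pullback (φ : E4 → E4) (hφ : ContDiffOn ℝ ∞ φ U) (hm : ∀ y ∈ U, φ y ∈ V) :
    SmoothFn V →ₐ[ℝ] SmoothFn U where
  toFun f := SmoothFn.mk (fun y => zeroExtend f.1 (φ y)) ((SmoothFn.contDiffOn f).comp hφ hm)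
  map_one' := ext_ev fun y => zeroExtend_apply _ ⟨φ y, hm y y.2⟩
  map_mul' f f' := ext_ev fun y => by
    simp only [map_mul, ev_mk]
    simp only [zeroExtend_apply _ (⟨φ y, hm y y.2⟩ : V)]; rfl
  map_zero' := ext_ev fun y => zeroExtend_apply _ ⟨φ y, hm y y.2⟩
  map_add' f f' := ext_ev fun y => by
    simp only [map_add, ev_mk]
    simp only [zeroExtend_apply _ (⟨φ y, hm y y.2⟩ : V)]; rfl
  commutes' r := ext_ev fun y => zeroExtend_apply _ ⟨φ y, hm y y.2⟩

theorem SmoothFn.ev_pullback (φ : E4 → E4) (hφ : ContDiffOn ℝ ∞ φ U) (hm : ∀ y ∈ U, φ y ∈ V)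
    (f : SmoothFn V) (y : U) : ev y (pullback φ hφ hm f) = ev ⟨φ y, hm y y.2⟩ f :=
  zeroExtend_apply _ ⟨φ y, hm y y.2⟩

theorem contDiffOn_apply {φ : E4 → E4} {s : Set E4} (hφ : ContDiffOn ℝ ∞ φ s) (k : Fin 4) :
    ContDiffOn ℝ ∞ (fun y => φ y k) s :=
  (EuclideanSpace.proj k : E4 →L[ℝ] ℝ).contDiff.comp_contDiffOn hφ

/-- The Jacobian matrix, as a matrix of smooth functions. -/
def jacobianFn (φ : E4 → E4) (hφ : ContDiffOn ℝ ∞ φ U) : Matrix (Fin 4) (Fin 4) (SmoothFn U) :=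
  Matrix.of fun k a => D a (SmoothFn.mk (fun y => φ y k) (contDiffOn_apply hφ k))

theorem ev_jacobianFn (φ : E4 → E4) (hφ : ContDiffOn ℝ ∞ φ U) (y : U) (k a : Fin 4) :
    ev y (jacobianFn φ hφ k a) = jacobian φ y k a :=
  (partialD_eq_ev (fun _ => rfl) a y).symm

/-- Chain rule. -/
theorem SmoothFn.deriv_pullback (φ : E4 → E4) (hφ : ContDiffOn ℝ ∞ φ U) (hm : ∀ y ∈ U, φ y ∈ V)
    (f : SmoothFn V) (a : Fin 4) :
    D a (pullback φ hφ hm f) = ∑ j, jacobianFn φ hφ j a * pullback φ hφ hm (D j f) := by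
  refine ext_ev fun y => ?_
  have hφd : DifferentiableAt ℝ φ y :=
    (hφ.contDiffAt (U.isOpen.mem_nhds y.2)).differentiableAt (by simp)
  have hfd := SmoothFn.differentiableAt f ⟨φ y, hm y y.2⟩
  rw [← partialD_eq_ev (F := fun z => zeroExtend f.1 (φ z)) (fun _ => rfl)]
  have h1 : partialD a (fun z => zeroExtend f.1 (φ z)) y
      = fderiv ℝ (zeroExtend f.1) (φ y) (fderiv ℝ φ y (basisVec a)) :=
    congrArg (fun L : E4 →L[ℝ] ℝ => L (basisVec a)) (fderiv_comp _ hfd hφd)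
  rw [h1, sum_basisVec (fderiv ℝ φ y (basisVec a)), map_sum, map_sum]
  refine Finset.sum_congr rfl fun k _ => ?_
  rw [map_smul, smul_eq_mul, map_mul, ev_jacobianFn, ev_pullback]
  congr 1
  have : fderiv ℝ (fun z => φ z k) y = (EuclideanSpace.proj k : E4 →L[ℝ] ℝ).comp (fderiv ℝ φ y) :=
      ((EuclideanSpace.proj k : E4 →L[ℝ] ℝ).hasFDerivAt.comp (y : E4) hφd.hasFDerivAt).fderiv
  simp only [jacobian, Matrix.of_apply, partialD]
  rw [this]; rfl

/-- The Ricci tensor of a metric transforms as a tensor under a change of coordinates. -/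
theorem metricRicci_transition {G G' : E4 → Matrix (Fin 4) (Fin 4) ℝ} (hG : IsMetricOn V G)
    (hG' : IsMetricOn U G') (φ : E4 → E4) (hφ : ContDiffOn ℝ ∞ φ U) (hm : ∀ y ∈ U, φ y ∈ V)
    (hGG' : ∀ y ∈ U, G' y = (jacobian φ y)ᵀ * G (φ y) * jacobian φ y) (y : U) (a c : Fin 4) :
    metricRicci G' y a c
      = ∑ i, ∑ l, jacobian φ y i a * jacobian φ y l c * metricRicci G (φ y) i l := by
  have hmat : hG'.mat = (jacobianFn φ hφ)ᵀ * hG.mat.map (pullback φ hφ hm) * jacobianFn φ hφ := by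
    refine Matrix.ext fun a b => ext_ev fun y => ?_
    rw [hG'.ev_mat, hGG' y y.2]
    simp only [Matrix.mul_apply, Matrix.transpose_apply, map_sum, map_mul, Matrix.map_apply,
      ev_pullback, ev_jacobianFn, hG.ev_mat]
  -- Nondegeneracy of `G'` forces the Jacobian to be invertible, since `det G'` contains its
  -- determinant as a factor.
  have hdet : ∀ y : U, ev y (jacobianFn φ hφ).det ≠ 0 := fun y => by
    rw [AlgHom.map_det]
    have h0 : (ev y).mapMatrix (jacobianFn φ hφ) = jacobian φ y :=
      Matrix.ext fun k a => ev_jacobianFn φ hφ y k a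
    rw [h0]
    intro h0
    have h1 := (hG'.isUnit_det y y.2).ne_zero
    rw [hGG' y y.2, Matrix.det_mul, h0, mul_zero] at h1
    exact h1 rfl
  obtain ⟨k, hk⟩ := exists_mul_eq_one _ hdet
  have hinv : (jacobianFn φ hφ)⁻¹ * jacobianFn φ hφ = 1 :=
    Matrix.nonsing_inv_mul _ (IsUnit.of_mul_eq_one_right k hk)
  rw [hG'.metricRicci_eq, hG.isLeviCivita.ric_pullback hinv (fun a b k => D_comm _ _ _)
    (pullback φ hφ hm) (fun a f => deriv_pullback φ hφ hm f a) hG'.isLeviCivita hmat]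
  simp only [map_sum, map_mul, ev_jacobianFn, ev_pullback, ← hG.metricRicci_eq]

end Transition

end CConn

namespace CConn

/-! ### Passage to the manifold -/

section Global

variable {M : Type*} [TopologicalSpace M] [ChartedSpace E4 M]

theorem components_smul (h : BilinField M) (Θ : M → ℝ) (e : OpenPartialHomeomorph M E4) :
    components (fun z => ((Θ z) ^ 2)⁻¹ • h z) e
      = conformalMetric (fun y => Θ (e.symm y)) (components h e) := rfl

theorem contDiffOn_comp_symm {e : OpenPartialHomeomorph M E4}
    (he : e ∈ IsManifold.maximalAtlas (𝓡 4) ∞ M) {Θ : M → ℝ} {s : Set M}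
    (hΘ : ContMDiffOn (𝓡 4) 𝓘(ℝ, ℝ) ∞ Θ s) :
    ContDiffOn ℝ ∞ (fun y => Θ (e.symm y)) (e.target ∩ e.symm ⁻¹' s) := by
  rw [← contMDiffOn_iff_contDiffOn]
  exact hΘ.comp ((contMDiffOn_symm_of_mem_maximalAtlas he).mono Set.inter_subset_left)
    Set.inter_subset_right

variable [IsManifold (𝓡 4) ∞ M]

theorem isMetricOn_components (g : PseudoRiemannianMetric M) {e : OpenPartialHomeomorph M E4}
    (he : e ∈ IsManifold.maximalAtlas (𝓡 4) ∞ M) {U : TopologicalSpace.Opens E4}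
    (hU : (U : Set E4) ⊆ e.target) : IsMetricOn U (components g.form e) where
  smooth a b := (contDiffOn_components g he a b).mono hU
  symm y _ a b := components_symm g e y a b
  isUnit_det _ hy := isUnit_det_components g he (hU hy)

/-- The part of the target of a chart that corresponds to an open set. -/
def targetOpens (e : OpenPartialHomeomorph M E4) {s : Set M} (hs : IsOpen s) :
    TopologicalSpace.Opens E4 :=
  ⟨e.target ∩ e.symm ⁻¹' s, e.isOpen_inter_preimage_symm hs⟩

/-- Near the point `𝒞` is the Levi-Civita connection of the Einstein metric. The factor `r` depends
on the point, as it absorbs `Θ⁻²`. -/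
theorem cRicci_of_locallyConformallyEinstein (g : PseudoRiemannianMetric M)
    (hC : WeylSqNeZero g) (hE : LocallyConformallyEinstein g) {e : OpenPartialHomeomorph M E4}
    (he : e ∈ IsManifold.maximalAtlas (𝓡 4) ∞ M) {y : E4} (hy : y ∈ e.target) :
    ∃ r : ℝ, ∀ a b, cRicci (components g.form e) y a b = r * components g.form e y a b := by
  obtain ⟨s, hs, hys, Θ, hΘ, hpos, c, hc⟩ := hE (e.symm y)
  have hm : IsMetricOn (targetOpens e hs) (components g.form e) :=
    isMetricOn_components g he Set.inter_subset_left
  refine ⟨c * ((Θ (e.symm y)) ^ 2)⁻¹, fun a b => ?_⟩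
  rw [hm.cRicci_eq_of_einstein (contDiffOn_comp_symm he hΘ) (fun z hz => hpos _ hz.2)
    (fun z hz a b => hc e he z hz.1 hz.2 a b) (fun z hz => hC e he z hz.1) ⟨y, hy, hys⟩ a b]
  simp [conformalMetric, mul_assoc]

theorem locallyConformallyEinstein_of_cRicci (g : PseudoRiemannianMetric M)
    (hC : WeylSqNeZero g) (hs : CRicciSkewPartVanishes g) (ht : CRicciTraceFreePartVanishes g) :
    LocallyConformallyEinstein g := by
  intro x
  set e := chartAt E4 x with he'
  have he : e ∈ IsManifold.maximalAtlas (𝓡 4) ∞ M := IsManifold.chart_mem_maximalAtlas x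
  have hx : x ∈ e.source := mem_chart_source E4 x
  -- A ball is taken because the integration of `Λ` requires a convex domain.
  obtain ⟨r, hr, hball⟩ := Metric.isOpen_iff.mp e.open_target (e x) (e.map_source hx)
  let V : TopologicalSpace.Opens E4 := ⟨Metric.ball (e x) r, Metric.isOpen_ball⟩
  have hm : IsMetricOn V (components g.form e) := isMetricOn_components g he hball
  obtain ⟨θ, hθ, hpos, c, hc⟩ := hm.exists_einstein (convex_ball _ _)
    (fun y hy => hC e he y (hball hy))
    (fun y hy a b => by linarith [hs e he y (hball hy) a b])
    (fun y hy a b => by linarith [ht e he y (hball hy) a b])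
  have hopen : IsOpen (e.source ∩ e ⁻¹' V) := e.isOpen_inter_preimage V.isOpen
  have hΘ : ContMDiffOn (𝓡 4) 𝓘(ℝ, ℝ) ∞ (fun z => θ (e z)) (e.source ∩ e ⁻¹' V) :=
    (contMDiffOn_iff_contDiffOn.mpr hθ).comp
      ((contMDiffOn_of_mem_maximalAtlas he).mono Set.inter_subset_left) Set.inter_subset_right
  refine ⟨e.source ∩ e ⁻¹' V, hopen, ⟨hx, Metric.mem_ball_self hr⟩, fun z => θ (e z), hΘ,
    fun z hz => hpos _ hz.2, c, fun e' he' y hy hyU a b => ?_⟩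
  -- The Einstein equation is so far known only in the chart `e`; both of its sides transform as
  -- tensors, which gives it in the arbitrary chart `e'`.
  have hm' : IsMetricOn (targetOpens e' hopen)
      (components (fun z => ((θ (e z)) ^ 2)⁻¹ • g.form z) e') :=
    (isMetricOn_components g he' Set.inter_subset_left).conformalMetric
      (contDiffOn_comp_symm he' hΘ) fun z hz => hpos _ hz.2.2
  have hsub : ∀ z ∈ targetOpens e' hopen, z ∈ (e'.symm.trans e).source := fun z hz => by
    simpa using ⟨hz.1, hz.2.1⟩
  have htr : ∀ z ∈ targetOpens e' hopen,
      components (fun z => ((θ (e z)) ^ 2)⁻¹ • g.form z) e' z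
        = (jacobian (fun y => e (e'.symm y)) z).transpose
          * conformalMetric θ (components g.form e) (e (e'.symm z))
          * jacobian (fun y => e (e'.symm y)) z := by
    intro z hz
    rw [components_transition _ he' he (hsub z hz), components_smul]
    simp only [conformalMetric]
    rw [e.right_inv (hball hz.2.2)]
  rw [metricRicci_transition (hm.conformalMetric hθ hpos) hm' (fun y => e (e'.symm y))
    ((contDiffOn_transition he' he).mono hsub) (fun z hz => hz.2.2) htr ⟨y, hy, hyU⟩ a b,
    htr y ⟨hy, hyU⟩]
  simp only [hc _ hyU.2, Matrix.mul_apply, Matrix.transpose_apply, Finset.mul_sum, Finset.sum_mul]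
  rw [Finset.sum_comm]
  exact Finset.sum_congr rfl fun i _ => Finset.sum_congr rfl fun l _ => by ring

end Global

end CConn

end

theorem mainTheorem1 {M : Type*} [TopologicalSpace M] [ChartedSpace CConn.E4 M]
    [IsManifold (𝓡 4) ∞ M] (g : CConn.PseudoRiemannianMetric M)
    (hC : CConn.WeylSqNeZero g) :
    CConn.LocallyConformallyEinstein g ↔
      (CConn.CRicciSkewPartVanishes g ∧ CConn.CRicciTraceFreePartVanishes g) := by
  refine ⟨fun hE => ⟨fun e he y hy a b => ?_, fun e he y hy a b => ?_⟩,
    fun h => CConn.locallyConformallyEinstein_of_cRicci g hC h.1 h.2⟩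
  · obtain ⟨r, hr⟩ := CConn.cRicci_of_locallyConformallyEinstein g hC hE he hy
    rw [hr, hr, CConn.components_symm g e y a b]; ring
  · obtain ⟨r, hr⟩ := CConn.cRicci_of_locallyConformallyEinstein g hC hE he hy
    have hm : CConn.IsMetricOn ⟨e.target, e.open_target⟩ (CConn.components g.form e) :=
      CConn.isMetricOn_components g he subset_rfl
    -- The trace of `r g` is `4 r`, so the trace-free part of the Ricci tensor vanishes.
    have h4 : CConn.cScalar (CConn.components g.form e) y = 4 * r := by
      have h1 : ∀ a, ∑ b, CConn.ginv (CConn.components g.form e) y a b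
          * (r * CConn.components g.form e y a b) = r := fun a => by
        have h2 := hm.sum_ginv_mul ⟨y, hy⟩ a a
        rw [if_pos rfl] at h2
        refine Eq.trans ?_ ((congrArg (r * ·) h2).trans (mul_one r))
        rw [Finset.mul_sum]
        exact Finset.sum_congr rfl fun b _ => by rw [CConn.components_symm g e y a b]; ring
      simp only [CConn.cScalar, hr, h1]
      simp
    rw [hr, h4]; ring
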